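/- Let $n_{\mathrm R},n_{\mathrm T}\ge 0$ be integers, let $\mathbf H$ be an arbitrary complex $n_{\mathrm R}\times n_{\mathrm T}$ matrix and let $N_0>0$. Let $\mathbf X\sim\mathcal{CN}(\mathbf 0,\mathbf I_{n_{\mathrm T}})$ and $\mathbf N\sim\mathcal{CN}(\mathbf 0,N_0\mathbf I_{n_{\mathrm R}})$ be independent circularly-symmetric complex Gaussian vectors, and let $\mathbf Y=\mathbf H\mathbf X+\mathbf N$. For a complex $n_{\mathrm T}\times n_{\mathrm R}$ matrix $\mathbf H_{\mathrm r}$ and a Hermitian $n_{\mathrm T}\times n_{\mathrm T}$ matrix $\mathbf G_{\mathrm r}$ put $$\tilde T(\mathbf y|\mathbf x)=\exp\left(2\,\mathrm{Re}\{\mathbf x^{\mathrm H}\mathbf H_{\mathrm r}\mathbf y\}-\mathbf x^{\mathrm H}\mathbf G_{\mathrm r}\mathbf x\right),\qquad \tilde T(\mathbf y)=\int \tilde T(\mathbf y|\mathbf x)\,p_{\mathbf X}(\mathbf x)\,\mathrm d\mathbf x\in[0,\infty],$$ where $p_{\mathbf X}$ is the density of $\mathbf X$, and define the generalized mutual information (in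 nats) $$I_{\mathrm{GMI}}(\mathbf H_{\mathrm r},\mathbf G_{\mathrm r})=-\mathbb E\left[\log\tilde T(\mathbf Y)\right]+\mathbb E\left[\log\tilde T(\mathbf Y|\mathbf X)\right]\in[-\infty,\infty],$$ which is $-\infty$ if the integral defining $\tilde T(\mathbf Y)$ diverges. Let $K_1,\dots,K_M$ be non-negative integers with $\sum_{m=1}^M K_m=n_{\mathrm T}$, and let $T_m=\sum_{\ell=1}^{m-1}K_\ell$. Then the maximum of $I_{\mathrm{GMI}}(\mathbf H_{\mathrm r},\mathbf G_{\mathrm r})$ over all complex $n_{\mathrm T}\times n_{\mathrm R}$ matrices $\mathbf H_{\mathrm r}$ and all Hermitian matrices $\mathbf G_{\mathrm r}$ that are block diagonal with consecutive diagonal blocks of sizes $K_1\times K_1,\dots,K_M\times K_M$ is attained, and it equals $$\sum_{m=1}^M\sum_{k=1}^{K_m} I\left(\mathbf Y;X_{T_m+k}\,\middle|\,X_{T_m+k-1},\dots,X_{T_m+1}\right),$$ where for $k=1$ there is no conditioning and $I(\cdot\,;\cdot\,|\,\cdot)$ is conditional mutual information in nats. In other words, the chain rule is applied within each block, with no conditioning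 across blocks. -/

import Mathlib

open MeasureTheory ProbabilityTheory InformationTheory Matrix
open scoped ENNReal

noncomputable section

namespace ChannelShortening

/-- The circularly-symmetric complex Gaussian law `CN(0, v)` on `ℂ`: real and imaginary parts are
independent real Gaussians with mean `0` and variance `v / 2`. -/
def complexGaussian (v : ℝ) : Measure ℂ :=
  ((gaussianReal 0 (v / 2).toNNReal).prod (gaussianReal 0 (v / 2).toNNReal)).map
    (fun p : ℝ × ℝ => (⟨p.1, p.2⟩ : ℂ))

/-- The law `CN(0, v I_n)` on `ℂⁿ`: i.i.d. coordinates with law `CN(0, v)`. -/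
def complexGaussianVec (n : ℕ) (v : ℝ) : Measure (Fin n → ℂ) :=
  Measure.pi fun _ => complexGaussian v

/-- The (mismatched) receiver function
`T(y | x) = exp (2 Re (xᴴ Hr y) - xᴴ Gr x)`; the form `xᴴ Gr x` is real for Hermitian `Gr`. -/
def receiverFun {nR nT : ℕ} (Hr : Matrix (Fin nT) (Fin nR) ℂ) (Gr : Matrix (Fin nT) (Fin nT) ℂ)
    (y : Fin nR → ℂ) (x : Fin nT → ℂ) : ℝ :=
  Real.exp (2 * (star x ⬝ᵥ (Hr *ᵥ y)).re - (star x ⬝ᵥ (Gr *ᵥ x)).re)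

/-- `T(y) = ∫ T(y | x) dP_X(x)`, with values in `[0, ∞]` (it is `∞` when the integral diverges). -/
def receiverMarginal {nR nT : ℕ} (PX : Measure (Fin nT → ℂ))
    (Hr : Matrix (Fin nT) (Fin nR) ℂ) (Gr : Matrix (Fin nT) (Fin nT) ℂ) (y : Fin nR → ℂ) : ℝ≥0∞ :=
  ∫⁻ x, ENNReal.ofReal (receiverFun Hr Gr y x) ∂PX

/-- Expectation of an extended-real random variable, `E[f⁺] - E[f⁻]`
(set to `-∞` if both are infinite). -/
def expectation {Ω : Type*} [MeasurableSpace Ω] (μ : Measure Ω) (f : Ω → EReal) : EReal :=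
  ((∫⁻ ω, (f ω).toENNReal ∂μ : ℝ≥0∞) : EReal) - ((∫⁻ ω, (-f ω).toENNReal ∂μ : ℝ≥0∞) : EReal)

/-- The generalized mutual information, in nats,
`I_GMI(Hr, Gr) = -E[log T(Y)] + E[log T(Y | X)]`, as an extended real: it is `-∞` when the
integral defining `T(Y)` diverges. -/
def gmi {nR nT : ℕ} {Ω : Type*} [MeasurableSpace Ω] (μ : Measure Ω)
    (X : Ω → Fin nT → ℂ) (Y : Ω → Fin nR → ℂ)
    (Hr : Matrix (Fin nT) (Fin nR) ℂ) (Gr : Matrix (Fin nT) (Fin nT) ℂ) : EReal :=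
  -expectation μ (fun ω => ENNReal.log (receiverMarginal (μ.map X) Hr Gr (Y ω))) +
    expectation μ (fun ω => ((Real.log (receiverFun Hr Gr (Y ω) (X ω)) : ℝ) : EReal))

/-- Conditional mutual information `I(A; B | Z)`, in nats: the Kullback-Leibler divergence of the
joint law `P_{Z,A,B}` from `P_Z ⊗ (P_{A|Z} × P_{B|Z})`. -/
def condMutualInfo {Ω α β γ : Type*} [MeasurableSpace Ω]
    [MeasurableSpace α] [StandardBorelSpace α] [Nonempty α]
    [MeasurableSpace β] [StandardBorelSpace β] [Nonempty β] [MeasurableSpace γ]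
    (μ : Measure Ω) [IsFiniteMeasure μ] (A : Ω → α) (B : Ω → β) (Z : Ω → γ) : ℝ≥0∞ :=
  klDiv (μ.map fun ω => (Z ω, (A ω, B ω)))
    (Measure.compProd (μ.map Z) (Kernel.prod (condDistrib A Z μ) (condDistrib B Z μ)))

/-- The offset `T_m = ∑_{l < m} K_l` of block `m`. -/
def blockStart {M : ℕ} (K : Fin M → ℕ) (m : Fin M) : ℕ := ∑ l ∈ Finset.Iio m, K l

theorem blockStart_add_lt {M n : ℕ} {K : Fin M → ℕ} (hK : ∑ m, K m = n) (m : Fin M)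
    (k : Fin (K m)) : blockStart K m + (k : ℕ) < n := by
  have h1 : ∑ l ∈ Finset.Iic m, K l ≤ ∑ l, K l :=
    Finset.sum_le_sum_of_subset (Finset.subset_univ _)
  have h2 : ∑ l ∈ Finset.Iic m, K l = blockStart K m + K m := by
    rw [← Finset.Iio_insert, Finset.sum_insert (by simp), add_comm, blockStart]
  have := k.2
  omega

/-- The position in `{0, …, n - 1}` of the `k`-th index (from `0`) of block `m`. -/
def blockIdx {M n : ℕ} {K : Fin M → ℕ} (hK : ∑ m, K m = n) (m : Fin M) (k : Fin (K m)) : Fin n :=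
  ⟨blockStart K m + (k : ℕ), blockStart_add_lt hK m k⟩

/-- `G` is block diagonal with consecutive diagonal blocks of sizes `K_m`: entries whose row and
column lie in different blocks vanish. -/
def IsBlockDiagonal {M n : ℕ} {K : Fin M → ℕ} (hK : ∑ m, K m = n) (G : Matrix (Fin n) (Fin n) ℂ) :
    Prop :=
  ∀ m m' : Fin M, m ≠ m' → ∀ (k : Fin (K m)) (l : Fin (K m')),
    G (blockIdx hK m k) (blockIdx hK m' l) = 0

/-- The symbols of block `m` that precede its `k`-th one. -/
def blockPast {M n : ℕ} {K : Fin M → ℕ} (hK : ∑ m, K m = n) {Ω : Type*} (X : Ω → Fin n → ℂ)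
    (m : Fin M) (k : Fin (K m)) (ω : Ω) : Fin (k : ℕ) → ℂ :=
  fun j => X ω (blockIdx hK m ⟨j, j.2.trans k.2⟩)

end ChannelShortening

end

noncomputable section

namespace ChannelShortening

/-! If `1 + Gr` is not positive definite, the integral defining `T(y)` diverges for every `y` and
the GMI is `-∞` (`receiverMarginal_eq_top`, `gmi_eq_bot`). Otherwise `exists_ldl` gives `1 + Gr = Uᴴ
D U` with `U` unit lower triangular and supported on the blocks. Since `Uᴴ D` is invertible, every
`Hr` has the form `Uᴴ D F`, so `(U, D, F)` parametrizes all remaining receivers.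

Completing the square (`receiver_exponent_eq`) turns the exponent into `‖x‖² - ∑ dᵢ |(Ux - Fy)ᵢ|² +
∑ dᵢ |(Fy)ᵢ|²`. The Gaussian integral is then explicit, and `gmi_eq_sum` gives the GMI as `∑ (log dᵢ
- dᵢ σᵢ² + 1)` with `σᵢ² = E|(UX - FY)ᵢ|²`. The rows decouple. Row `i` of `(U, F)` is an arbitrary
linear estimator of `Xᵢ` from `Y` and the earlier symbols of its block, so all the `σᵢ²` reach their
MMSE values `sᵢ` simultaneously (`exists_mmse`); then `dᵢ = 1 / sᵢ` is optimal and the sum is `∑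
-log sᵢ`.

By joint Gaussianity the MMSE error, being orthogonal to `Y` and the past, is independent of them.
As `Xᵢ` is `CN(0, 1)` and independent of its past, `-log sᵢ` is exactly the conditional mutual
information of `Y` and `Xᵢ` given that past (`condMutualInfo_eq_of_innovation`). -/

/-! ### Densities, characteristic functions and second moments of complex Gaussians. -/

theorem lintegral_pi_prod {n : ℕ} {E : Fin n → Type*} {mE : ∀ i, MeasurableSpace (E i)}
    (μ : (i : Fin n) → Measure (E i)) [∀ i, SigmaFinite (μ i)]
    (f : (i : Fin n) → E i → ℝ≥0∞) (hf : ∀ i, Measurable (f i)) :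
    ∫⁻ x : (i : Fin n) → E i, ∏ i, f i (x i) ∂(Measure.pi μ) = ∏ i, ∫⁻ x, f i x ∂(μ i) := by
  induction n with
  | zero => simp
  | succ n ih =>
    rw [← ((measurePreserving_piFinSuccAbove μ 0).symm).lintegral_comp_emb
      (MeasurableEquiv.measurableEmbedding _)]
    have hg : Measurable fun x : (i : Fin n) → E i.succ => ∏ i, f i.succ (x i) :=
      Finset.measurable_prod _ fun i _ => (hf i.succ).comp (measurable_pi_apply i)
    rw [Fin.prod_univ_succ, ← ih (fun i => μ i.succ) (fun i => f i.succ) (fun i => hf _),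
      ← lintegral_prod_mul (hf 0).aemeasurable hg.aemeasurable]
    refine lintegral_congr fun x => ?_
    rw [Fin.prod_univ_succ]
    rfl

theorem pi_withDensity {n : ℕ} {E : Fin n → Type*} {mE : ∀ i, MeasurableSpace (E i)}
    (μ : (i : Fin n) → Measure (E i)) [∀ i, SigmaFinite (μ i)]
    (f : (i : Fin n) → E i → ℝ≥0∞) (hf : ∀ i, Measurable (f i))
    [∀ i, SigmaFinite ((μ i).withDensity (f i))] :
    Measure.pi (fun i => (μ i).withDensity (f i)) =
      (Measure.pi μ).withDensity (fun x => ∏ i, f i (x i)) := by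
  refine (Measure.pi_eq fun s hs => ?_)
  rw [withDensity_apply _ (MeasurableSet.univ_pi hs), ← lintegral_indicator (MeasurableSet.univ_pi hs)]
  have : (Set.univ.pi s).indicator (fun x : (i : Fin n) → E i => ∏ i, f i (x i)) =
      fun x => ∏ i, (s i).indicator (f i) (x i) := by
    ext x
    by_cases hx : x ∈ Set.univ.pi s
    · rw [Set.indicator_of_mem hx]
      exact Finset.prod_congr rfl fun i _ => (Set.indicator_of_mem (hx i trivial) _).symm
    · rw [Set.indicator_of_notMem hx]
      simp only [Set.mem_pi, Set.mem_univ, true_imp_iff, not_forall] at hx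
      obtain ⟨i, hi⟩ := hx
      exact (Finset.prod_eq_zero (Finset.mem_univ i) (Set.indicator_of_notMem hi _)).symm
  rw [this, lintegral_pi_prod μ _ fun i => (hf i).indicator (hs i)]
  exact Finset.prod_congr rfl fun i _ => by
    rw [withDensity_apply _ (hs i), lintegral_indicator (hs i)]

instance (v : ℝ) : IsProbabilityMeasure (complexGaussian v) := by
  unfold complexGaussian
  exact Measure.isProbabilityMeasure_map
    (Complex.measurableEquivRealProd.symm.measurable.aemeasurable)

instance (n : ℕ) (v : ℝ) : IsProbabilityMeasure (complexGaussianVec n v) := by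
  unfold complexGaussianVec; infer_instance

/-- The density of `CN(0, v)` with respect to Lebesgue measure. -/
def complexGaussianPDF (v : ℝ) (z : ℂ) : ℝ≥0∞ :=
  ENNReal.ofReal ((Real.pi * v)⁻¹ * Real.exp (-(‖z‖ ^ 2 / v)))

theorem measurable_complexGaussianPDF (v : ℝ) : Measurable (complexGaussianPDF v) := by
  unfold complexGaussianPDF; fun_prop

theorem complexGaussian_eq_withDensity {v : ℝ} (hv : 0 < v) :
    complexGaussian v = volume.withDensity (complexGaussianPDF v) := by
  have hv2 : (v / 2).toNNReal ≠ 0 := by simpa using hv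
  unfold complexGaussian
  rw [gaussianReal_of_var_ne_zero _ hv2,
    prod_withDensity (measurable_gaussianPDF _ _) (measurable_gaussianPDF _ _)]
  ext s hs
  have hmeas : Measurable (fun p : ℝ × ℝ => (⟨p.1, p.2⟩ : ℂ)) :=
    Complex.measurableEquivRealProd.symm.measurable
  rw [Measure.map_apply hmeas hs, withDensity_apply _ (hmeas hs), withDensity_apply _ hs,
    ← Complex.volume_preserving_equiv_real_prod.symm.setLIntegral_comp_preimage hs
      (measurable_complexGaussianPDF v)]
  refine lintegral_congr fun p => ?_
  rw [gaussianPDF, gaussianPDF, ← ENNReal.ofReal_mul (gaussianPDFReal_nonneg _ _ _),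
    complexGaussianPDF, gaussianPDFReal, gaussianPDFReal]
  congr 1
  have h1 : ‖Complex.measurableEquivRealProd.symm p‖ ^ 2 = p.1 ^ 2 + p.2 ^ 2 := by
    rw [← Complex.normSq_eq_norm_sq, Complex.normSq_apply]
    simp [Complex.measurableEquivRealProd_symm_apply]; ring
  rw [h1, Real.coe_toNNReal _ (by positivity)]
  have h2 : √(2 * Real.pi * (v / 2)) ^ 2 = Real.pi * v := by
    rw [Real.sq_sqrt (by positivity)]; ring
  rw [← h2, mul_mul_mul_comm, ← Real.exp_add, ← mul_inv, ← sq]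
  congr 2
  field_simp
  ring

/-- The integrand is `π / d` times the density of `CN(0, 1/d)`, whose total mass is one. -/
theorem lintegral_exp_neg_mul_sq {d : ℝ} (hd : 0 < d) :
    ∫⁻ z : ℂ, ENNReal.ofReal (Real.exp (-(d * ‖z‖ ^ 2))) = ENNReal.ofReal (Real.pi / d) := by
  have h := measure_univ (μ := complexGaussian d⁻¹)
  rw [complexGaussian_eq_withDensity (inv_pos.2 hd), withDensity_apply _ .univ,
    Measure.restrict_univ] at h
  have h2 : ∀ z : ℂ, ENNReal.ofReal (Real.exp (-(d * ‖z‖ ^ 2))) =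
      ENNReal.ofReal (Real.pi / d) * complexGaussianPDF d⁻¹ z := by
    intro z
    rw [complexGaussianPDF, ← ENNReal.ofReal_mul (by positivity)]
    congr 1
    have : ‖z‖ ^ 2 / d⁻¹ = d * ‖z‖ ^ 2 := by field_simp
    rw [this]
    field_simp
  simp_rw [h2]
  rw [lintegral_const_mul _ (measurable_complexGaussianPDF _), h, mul_one]

theorem complexGaussianVec_eq_withDensity (n : ℕ) {v : ℝ} (hv : 0 < v) :
    complexGaussianVec n v =
      volume.withDensity (fun x : Fin n → ℂ => ∏ i, complexGaussianPDF v (x i)) := by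
  have : SigmaFinite ((volume : Measure ℂ).withDensity (complexGaussianPDF v)) := by
    rw [← complexGaussian_eq_withDensity hv]; infer_instance
  unfold complexGaussianVec
  rw [complexGaussian_eq_withDensity hv]
  exact pi_withDensity (fun _ => volume) _ fun _ => measurable_complexGaussianPDF v

/-- `Re (c z)` splits into independent real and imaginary contributions, so this is a product of two
real Gaussian characteristic functions of variance `v / 2`; hence the factor `1 / 4`. -/
theorem integral_complexGaussian_exp {v : ℝ} (hv : 0 ≤ v) (c : ℂ) :
    ∫ z, Complex.exp ((c * z).re * Complex.I) ∂(complexGaussian v) =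
      Complex.exp (-(v * ‖c‖ ^ 2 / 4 : ℝ)) := by
  have hmeas : Measurable (fun p : ℝ × ℝ => (⟨p.1, p.2⟩ : ℂ)) :=
    Complex.measurableEquivRealProd.symm.measurable
  unfold complexGaussian
  rw [integral_map hmeas.aemeasurable (by fun_prop)]
  have h1 : ∀ p : ℝ × ℝ, Complex.exp (((c * (⟨p.1, p.2⟩ : ℂ)).re : ℝ) * Complex.I) =
      Complex.exp ((c.re : ℝ) * p.1 * Complex.I) * Complex.exp ((-c.im : ℝ) * p.2 * Complex.I) := by
    intro p
    rw [← Complex.exp_add]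
    congr 1
    simp [Complex.mul_re]
    ring
  simp_rw [h1]
  rw [integral_prod_mul (fun x : ℝ => Complex.exp ((c.re : ℝ) * x * Complex.I))
    (fun x : ℝ => Complex.exp ((-c.im : ℝ) * x * Complex.I)), ← charFun_apply_real,
    ← charFun_apply_real, charFun_gaussianReal, charFun_gaussianReal, ← Complex.exp_add]
  congr 1
  rw [← Complex.normSq_eq_norm_sq, Complex.normSq_apply]
  have : (((v / 2).toNNReal : ℝ) : ℂ) = v / 2 := by
    rw [Real.coe_toNNReal _ (by positivity)]; push_cast; rfl
  simp only [Complex.ofReal_zero, mul_zero, zero_mul]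
  rw [show (((v / 2).toNNReal : NNReal) : ℂ) = (((v / 2).toNNReal : ℝ) : ℂ) from rfl, this]
  push_cast
  ring

theorem integrable_complexGaussian_sq (v : ℝ) :
    Integrable (fun z : ℂ => ‖z‖ ^ 2) (complexGaussian v) := by
  have hmeas : Measurable (fun p : ℝ × ℝ => (⟨p.1, p.2⟩ : ℂ)) :=
    Complex.measurableEquivRealProd.symm.measurable
  unfold complexGaussian
  rw [integrable_map_measure (by fun_prop) hmeas.aemeasurable]
  have h : (fun z : ℂ => ‖z‖ ^ 2) ∘ (fun p : ℝ × ℝ => (⟨p.1, p.2⟩ : ℂ)) =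
      fun p : ℝ × ℝ => p.1 ^ 2 + p.2 ^ 2 := by
    ext p
    simp only [Function.comp, ← Complex.normSq_eq_norm_sq, Complex.normSq_apply]; ring
  rw [h]
  have h0 := (memLp_id_gaussianReal' (μ := 0) (v := (v / 2).toNNReal) 2 (by simp)).integrable_sq
  exact (h0.comp_fst _).add (h0.comp_snd _)

theorem integral_complexGaussian_sq {v : ℝ} (hv : 0 ≤ v) :
    ∫ z : ℂ, ‖z‖ ^ 2 ∂(complexGaussian v) = v := by
  have hmeas : Measurable (fun p : ℝ × ℝ => (⟨p.1, p.2⟩ : ℂ)) :=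
    Complex.measurableEquivRealProd.symm.measurable
  unfold complexGaussian
  rw [integral_map hmeas.aemeasurable (by fun_prop)]
  have h : ∀ p : ℝ × ℝ, ‖(⟨p.1, p.2⟩ : ℂ)‖ ^ 2 = p.1 ^ 2 + p.2 ^ 2 := by
    intro p
    simp only [← Complex.normSq_eq_norm_sq, Complex.normSq_apply]; ring
  simp_rw [h]
  have h0 : Integrable (fun x : ℝ => x ^ 2) (gaussianReal 0 (v / 2).toNNReal) :=
    (memLp_id_gaussianReal' (μ := 0) (v := (v / 2).toNNReal) 2 (by simp)).integrable_sq
  have h1 : ∫ x, x ^ 2 ∂(gaussianReal 0 (v / 2).toNNReal) = v / 2 := by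
    have := variance_fun_id_gaussianReal (μ := 0) (v := (v / 2).toNNReal)
    rw [variance_eq_integral (by fun_prop), integral_id_gaussianReal] at this
    have hm : max (v / 2) 0 = v / 2 := max_eq_left (by positivity)
    simpa [hm] using this
  rw [integral_add (h0.comp_fst _) (h0.comp_snd _),
    integral_fun_fst (fun x : ℝ => x ^ 2), integral_fun_snd (fun x : ℝ => x ^ 2), h1]
  simp

/-! ### The Gaussian integral of the receiver function and its divergence. -/

/-- The real determinant of a complex-linear map is the norm from `ℂ` to `ℝ` of its complex
determinant, hence `1` here. -/
theorem measurePreserving_mulVec {n : ℕ} (U : Matrix (Fin n) (Fin n) ℂ) (hU : U.det = 1) :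
    MeasurePreserving (fun x : Fin n → ℂ => U *ᵥ x) volume volume := by
  have hdet : LinearMap.det ((Matrix.toLin' U).restrictScalars ℝ) = 1 := by
    rw [LinearMap.det_restrictScalars, LinearMap.det_toLin', hU, map_one]
  have h := Measure.map_linearMap_addHaar_eq_smul_addHaar
    (volume : Measure (Fin n → ℂ)) (f := (Matrix.toLin' U).restrictScalars ℝ) (by simp [hdet])
  refine ⟨?_, ?_⟩
  · fun_prop
  · rw [hdet] at h
    simp only [inv_one, abs_one, ENNReal.ofReal_one, one_smul] at h
    exact h

/-- The term `‖x‖²` cancels the exponent of the Gaussian density, leaving `π⁻ⁿ`. The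
volume-preserving substitution by `U` and a translation by `c` then reduce the integral to a product
of one-dimensional ones. -/
theorem lintegral_exp_sub_sq {n : ℕ} (U : Matrix (Fin n) (Fin n) ℂ) (hU : U.det = 1)
    (d : Fin n → ℝ) (hd : ∀ i, 0 < d i) (c : Fin n → ℂ) :
    ∫⁻ x, ENNReal.ofReal (Real.exp (∑ i, ‖x i‖ ^ 2 - ∑ i, d i * ‖(U *ᵥ x) i - c i‖ ^ 2))
      ∂(complexGaussianVec n 1) = ENNReal.ofReal (∏ i, (d i)⁻¹) := by
  have hm : Measurable fun x : Fin n → ℂ => ∏ i, complexGaussianPDF 1 (x i) :=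
    Finset.measurable_prod _ fun i _ =>
      (measurable_complexGaussianPDF 1).comp (measurable_pi_apply i)
  rw [complexGaussianVec_eq_withDensity n one_pos,
    lintegral_withDensity_eq_lintegral_mul₀ hm.aemeasurable (by fun_prop)]
  let g : (Fin n → ℂ) → ℝ≥0∞ := fun x =>
    ∏ i, ENNReal.ofReal Real.pi⁻¹ * ENNReal.ofReal (Real.exp (-(d i * ‖x i‖ ^ 2)))
  have hg : Measurable g := by
    refine Finset.measurable_prod _ fun i _ => ?_
    fun_prop
  calc _ = ∫⁻ x, g (U *ᵥ x - c) := by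
        refine lintegral_congr fun x => ?_
        simp only [Pi.mul_apply, g, complexGaussianPDF, mul_one, div_one, Pi.sub_apply]
        simp_rw [ENNReal.ofReal_mul (inv_nonneg.2 Real.pi_pos.le)]
        rw [Finset.prod_mul_distrib, Finset.prod_mul_distrib, mul_assoc]
        congr 1
        rw [← ENNReal.ofReal_prod_of_nonneg fun i _ => (Real.exp_pos _).le,
          ← ENNReal.ofReal_prod_of_nonneg fun i _ => (Real.exp_pos _).le,
          ← ENNReal.ofReal_mul (Finset.prod_nonneg fun i _ => (Real.exp_pos _).le),
          ← Real.exp_sum, ← Real.exp_sum, ← Real.exp_add]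
        congr 2
        simp only [Finset.sum_neg_distrib]
        ring
    _ = ∫⁻ x, g (x - c) :=
        (measurePreserving_mulVec U hU).lintegral_comp (f := fun x => g (x - c))
          (hg.comp (by fun_prop))
    _ = ∫⁻ x, g x := lintegral_sub_right_eq_self g c
    _ = ∏ i, (d i)⁻¹.toNNReal := by
        simp only [g]
        rw [volume_pi, lintegral_pi_prod (fun _ : Fin n => (volume : Measure ℂ))
          (fun i z => ENNReal.ofReal Real.pi⁻¹ * ENNReal.ofReal (Real.exp (-(d i * ‖z‖ ^ 2))))
          (fun i => by fun_prop)]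
        push_cast
        refine Finset.prod_congr rfl fun i _ => ?_
        rw [lintegral_const_mul _ (by fun_prop), lintegral_exp_neg_mul_sq (hd i),
          ← ENNReal.ofReal_mul (by positivity)]
        have := Real.pi_pos.ne'
        change ENNReal.ofReal _ = ENNReal.ofReal _
        congr 1
        field_simp
    _ = _ := by
        rw [ENNReal.ofReal_prod_of_nonneg fun i _ => (inv_pos.2 (hd i)).le]
        push_cast
        rfl

/-- If `1 + Gr` is not positive definite, the integral defining `T(y)` diverges for every `y`. -/
theorem receiverMarginal_eq_top {nR n : ℕ} (Hr : Matrix (Fin n) (Fin nR) ℂ)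
    (Gr : Matrix (Fin n) (Fin n) ℂ) (v : Fin n → ℂ) (hv : v ≠ 0)
    (hvG : ∑ i, ‖v i‖ ^ 2 + (star v ⬝ᵥ (Gr *ᵥ v)).re ≤ 0) (y : Fin nR → ℂ) :
    receiverMarginal (complexGaussianVec n 1) Hr Gr y = ⊤ := by
  have hm : Measurable fun x : Fin n → ℂ => ∏ i, complexGaussianPDF 1 (x i) :=
    Finset.measurable_prod _ fun i _ =>
      (measurable_complexGaussianPDF 1).comp (measurable_pi_apply i)
  have hcr : Continuous (receiverFun Hr Gr y) := by
    unfold receiverFun; fun_prop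
  let φ : (Fin n → ℂ) → ℝ := fun x =>
    2 * (star x ⬝ᵥ (Hr *ᵥ y)).re - (star x ⬝ᵥ (Gr *ᵥ x)).re - ∑ i, ‖x i‖ ^ 2
  have hcφ : Continuous φ := by
    simp only [φ]; fun_prop
  let f : (Fin n → ℂ) → ℝ≥0∞ := fun x => ENNReal.ofReal (Real.exp (φ x))
  have hcf : Continuous f := ENNReal.continuous_ofReal.comp (Real.continuous_exp.comp hcφ)
  have hrec : receiverMarginal (complexGaussianVec n 1) Hr Gr y =
      (∏ _i : Fin n, ENNReal.ofReal Real.pi⁻¹) * ∫⁻ x, f x := by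
    unfold receiverMarginal
    rw [complexGaussianVec_eq_withDensity n one_pos,
      lintegral_withDensity_eq_lintegral_mul₀ hm.aemeasurable (by fun_prop),
      ← lintegral_const_mul _ hcf.measurable]
    refine lintegral_congr fun x => ?_
    simp only [Pi.mul_apply, complexGaussianPDF, mul_one, div_one, receiverFun, f]
    simp_rw [ENNReal.ofReal_mul (inv_nonneg.2 Real.pi_pos.le)]
    rw [Finset.prod_mul_distrib, mul_assoc]
    congr 1
    rw [← ENNReal.ofReal_prod_of_nonneg fun i _ => (Real.exp_pos _).le,
      ← ENNReal.ofReal_mul (Finset.prod_nonneg fun i _ => (Real.exp_pos _).le),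
      ← Real.exp_sum, ← Real.exp_add]
    congr 2
    simp only [Finset.sum_neg_distrib, φ]
    ring
  rw [hrec]
  refine ENNReal.mul_eq_top.2 (Or.inl ⟨?_, ?_⟩)
  · exact Finset.prod_ne_zero_iff.2 fun i _ => by simp [Real.pi_pos]
  by_contra hfin
  -- The second difference of the quadratic `φ` along `v` is nonnegative by `hvG`, so `φ` cannot
  -- decrease in both directions `±t v`.
  have hpar : ∀ (t : ℝ) (x : Fin n → ℂ), φ x ≤ φ (x + (t : ℂ) • v) ∨ φ x ≤ φ (x - (t : ℂ) • v) := by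
    intro t x
    have hsum : φ (x + (t : ℂ) • v) + φ (x - (t : ℂ) • v) = 2 * φ x - 2 * t ^ 2 *
        (∑ i, ‖v i‖ ^ 2 + (star v ⬝ᵥ (Gr *ᵥ v)).re) := by
      have h1 : ∑ i, ‖(x + (t : ℂ) • v) i‖ ^ 2 + ∑ i, ‖(x - (t : ℂ) • v) i‖ ^ 2 =
          2 * ∑ i, ‖x i‖ ^ 2 + 2 * t ^ 2 * ∑ i, ‖v i‖ ^ 2 := by
        rw [← Finset.sum_add_distrib, Finset.mul_sum, Finset.mul_sum, ← Finset.sum_add_distrib]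
        refine Finset.sum_congr rfl fun i _ => ?_
        simp only [← Complex.normSq_eq_norm_sq, Complex.normSq_apply, Pi.add_apply, Pi.sub_apply,
          Pi.smul_apply, smul_eq_mul, Complex.add_re, Complex.add_im, Complex.sub_re,
          Complex.sub_im, Complex.re_ofReal_mul, Complex.im_ofReal_mul]
        ring
      simp only [φ]
      simp only [star_add, star_sub, star_smul, mulVec_add, mulVec_sub, mulVec_smul,
        add_dotProduct, sub_dotProduct, dotProduct_add, dotProduct_sub, smul_dotProduct,
        dotProduct_smul, smul_eq_mul, Complex.add_re, Complex.sub_re, RCLike.star_def,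
        Complex.conj_ofReal, Complex.re_ofReal_mul] at h1 ⊢
      linear_combination -h1
    have : 0 ≤ - (2 * t ^ 2 * (∑ i, ‖v i‖ ^ 2 + (star v ⬝ᵥ (Gr *ᵥ v)).re)) := by
      nlinarith [sq_nonneg t]
    by_contra! hlt
    linarith [hlt.1, hlt.2]
  let B : Set (Fin n → ℂ) := Metric.ball 0 1
  have hB : MeasurableSet B := measurableSet_ball
  -- If `f` were integrable, its mass on balls escaping to infinity along `v` would tend to zero, by
  -- dominated convergence.
  have hlim : ∀ s : ℝ, s ≠ 0 → Filter.Tendsto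
      (fun k : ℕ => ∫⁻ x in B, f (x + (((k : ℝ) * s : ℝ) : ℂ) • v)) Filter.atTop (nhds 0) := by
    intro s hs
    have h1 : ∀ k : ℕ, ∫⁻ x in B, f (x + (((k : ℝ) * s : ℝ) : ℂ) • v) =
        ∫⁻ x, B.indicator 1 (x - (((k : ℝ) * s : ℝ) : ℂ) • v) * f x := by
      intro k
      rw [← lintegral_indicator hB, ← lintegral_sub_right_eq_self _ ((((k : ℝ) * s : ℝ) : ℂ) • v)]
      refine lintegral_congr fun x => ?_
      by_cases hx : x - (((k : ℝ) * s : ℝ) : ℂ) • v ∈ B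
      · rw [Set.indicator_of_mem hx, Set.indicator_of_mem hx, sub_add_cancel, Pi.one_apply, one_mul]
      · rw [Set.indicator_of_notMem hx, Set.indicator_of_notMem hx, zero_mul]
    simp_rw [h1]
    rw [← lintegral_zero (μ := (volume : Measure (Fin n → ℂ)))]
    refine tendsto_lintegral_of_dominated_convergence f ?_ ?_ hfin ?_
    · intro k
      exact ((measurable_one.indicator hB).comp (by fun_prop)).mul hcf.measurable
    · intro k
      refine Filter.Eventually.of_forall fun x => ?_
      refine (mul_le_mul_left (Set.indicator_le_self' (f := 1) (by simp) _) (f x)).trans ?_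
      simp
    · refine Filter.Eventually.of_forall fun x => ?_
      refine tendsto_const_nhds.congr' ?_
      have htop : Filter.Tendsto (fun k : ℕ => (k : ℝ) * (|s| * ‖v‖)) Filter.atTop Filter.atTop :=
        tendsto_natCast_atTop_atTop.atTop_mul_const (by positivity)
      filter_upwards [htop.eventually_ge_atTop (1 + ‖x‖)] with k hk
      have : x - (((k : ℝ) * s : ℝ) : ℂ) • v ∉ B := by
        simp only [B, mem_ball_zero_iff, not_lt]
        have h2 : ‖(((k : ℝ) * s : ℝ) : ℂ) • v‖ = k * (|s| * ‖v‖) := by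
          rw [norm_smul, Complex.norm_real, norm_mul]; simp [mul_assoc]
        have := norm_sub_norm_le ((((k : ℝ) * s : ℝ) : ℂ) • v) x
        rw [norm_sub_rev] at this
        linarith
      rw [Set.indicator_of_notMem this, zero_mul]
  -- By `hpar`, the mass on `B` is bounded by the masses on its two translates by `±k v`. Letting `k
  -- → ∞` makes it zero, although `f > 0`.
  have hle : ∀ k : ℕ, ∫⁻ x in B, f x ≤ (∫⁻ x in B, f (x + (((k : ℝ) * 1 : ℝ) : ℂ) • v)) +
      ∫⁻ x in B, f (x + (((k : ℝ) * (-1) : ℝ) : ℂ) • v) := by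
    intro k
    have hmk : Measurable fun x => f (x + (((k : ℝ) * 1 : ℝ) : ℂ) • v) :=
      hcf.measurable.comp (by fun_prop)
    rw [← lintegral_add_left hmk]
    refine lintegral_mono fun x => ?_
    rcases hpar k x with h | h
    · refine le_add_right (ENNReal.ofReal_le_ofReal (Real.exp_le_exp.2 ?_))
      simpa using h
    · refine le_add_left (ENNReal.ofReal_le_ofReal (Real.exp_le_exp.2 ?_))
      simpa [sub_eq_add_neg] using h
  have h0 := ge_of_tendsto' ((hlim 1 one_ne_zero).add (hlim (-1) (by norm_num))) hle
  have hpos : 0 < ∫⁻ x in B, f x := by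
    rw [setLIntegral_pos_iff hcf.measurable]
    have : Function.support f = Set.univ := by
      ext x; simp [f, Real.exp_pos]
    rw [this, Set.univ_inter]
    exact Metric.measure_ball_pos _ _ one_pos
  simp at h0
  exact hpos.ne' h0

/-! ### The value of the GMI for a completed square. -/

theorem expectation_coe {Ω : Type*} [MeasurableSpace Ω] (μ : Measure Ω) (f : Ω → ℝ)
    (hf : Integrable f μ) :
    expectation μ (fun ω => (f ω : EReal)) = ((∫ ω, f ω ∂μ : ℝ) : EReal) := by
  unfold expectation
  have h1 : ∀ x : ℝ, (x : EReal).toENNReal = ENNReal.ofReal x := fun x => rfl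
  have h2 : ∀ x : ℝ, (-(x : EReal)).toENNReal = ENNReal.ofReal (-x) := fun x => rfl
  simp_rw [h1, h2]
  rw [integral_eq_lintegral_pos_part_sub_lintegral_neg_part hf, EReal.coe_sub,
    EReal.coe_ennreal_toReal, EReal.coe_ennreal_toReal]
  · exact (hf.neg.lintegral_lt_top).ne
  · exact (hf.lintegral_lt_top).ne

/-- The first expectation is `⊤`, and its negative `⊥` absorbs whatever the second one is in `EReal`
addition. -/
theorem gmi_eq_bot {nR n : ℕ} {Ω : Type*} [MeasurableSpace Ω] (μ : Measure Ω)
    [IsProbabilityMeasure μ]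
    (X : Ω → Fin n → ℂ) (Y : Ω → Fin nR → ℂ) (hX : μ.map X = complexGaussianVec n 1)
    (Hr : Matrix (Fin n) (Fin nR) ℂ) (Gr : Matrix (Fin n) (Fin n) ℂ) (v : Fin n → ℂ) (hv : v ≠ 0)
    (hvG : ∑ i, ‖v i‖ ^ 2 + (star v ⬝ᵥ (Gr *ᵥ v)).re ≤ 0) :
    gmi μ X Y Hr Gr = ⊥ := by
  unfold gmi
  simp_rw [hX, receiverMarginal_eq_top Hr Gr v hv hvG]
  simp [expectation]

/-- The marginal is `exp (∑ dᵢ |(Fy)ᵢ|²) ∏ dᵢ⁻¹`. Its exponent cancels against the last term of `hq`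
in the difference of expectations, and `E|Xᵢ|² = 1` contributes the `+ 1` of each summand. -/
theorem gmi_eq_of_quadratic {nR n : ℕ} {Ω : Type*} [MeasurableSpace Ω] (μ : Measure Ω)
    [IsProbabilityMeasure μ] (X : Ω → Fin n → ℂ) (Y : Ω → Fin nR → ℂ)
    (hX : μ.map X = complexGaussianVec n 1)
    (Hr : Matrix (Fin n) (Fin nR) ℂ) (Gr : Matrix (Fin n) (Fin n) ℂ)
    (U : Matrix (Fin n) (Fin n) ℂ) (hU : U.det = 1) (d : Fin n → ℝ) (hd : ∀ i, 0 < d i)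
    (F : Matrix (Fin n) (Fin nR) ℂ)
    (hq : ∀ x y, 2 * (star x ⬝ᵥ (Hr *ᵥ y)).re - (star x ⬝ᵥ (Gr *ᵥ x)).re =
      ∑ i, ‖x i‖ ^ 2 - ∑ i, d i * ‖(U *ᵥ x) i - (F *ᵥ y) i‖ ^ 2 + ∑ i, d i * ‖(F *ᵥ y) i‖ ^ 2)
    (hXi : ∀ i, Integrable (fun ω => ‖X ω i‖ ^ 2) μ) (hX1 : ∀ i, ∫ ω, ‖X ω i‖ ^ 2 ∂μ = 1)
    (hFY : ∀ i, Integrable (fun ω => ‖(F *ᵥ Y ω) i‖ ^ 2) μ)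
    (hUF : ∀ i, Integrable (fun ω => ‖(U *ᵥ X ω) i - (F *ᵥ Y ω) i‖ ^ 2) μ) :
    gmi μ X Y Hr Gr =
      ((∑ i, (Real.log (d i) - d i * ∫ ω, ‖(U *ᵥ X ω) i - (F *ᵥ Y ω) i‖ ^ 2 ∂μ + 1) : ℝ) :
        EReal) := by
  have hT : ∀ y, ENNReal.log (receiverMarginal (μ.map X) Hr Gr y) =
      ((∑ i, d i * ‖(F *ᵥ y) i‖ ^ 2 - ∑ i, Real.log (d i) : ℝ) : EReal) := by
    intro y
    have : receiverMarginal (μ.map X) Hr Gr y =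
        ENNReal.ofReal (Real.exp (∑ i, d i * ‖(F *ᵥ y) i‖ ^ 2) * ∏ i, (d i)⁻¹) := by
      unfold receiverMarginal receiverFun
      simp_rw [hq, Real.exp_add]
      simp_rw [mul_comm (Real.exp (_ - _)), ENNReal.ofReal_mul (Real.exp_pos _).le]
      rw [lintegral_const_mul _ (by fun_prop), hX, lintegral_exp_sub_sq U hU d hd]
    have hpos : 0 < ∏ i, (d i)⁻¹ := Finset.prod_pos fun i _ => inv_pos.2 (hd i)
    rw [this, ENNReal.log_ofReal_of_pos (by positivity),
      Real.log_mul (Real.exp_pos _).ne' hpos.ne', Real.log_exp,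
      Real.log_prod (fun i _ => (inv_pos.2 (hd i)).ne')]
    simp only [Real.log_inv, Finset.sum_neg_distrib, sub_eq_add_neg]
  have hi1 : Integrable (fun ω => ∑ i, d i * ‖(F *ᵥ Y ω) i‖ ^ 2) μ :=
    integrable_finsetSum _ fun i _ => (hFY i).const_mul _
  have hi2 : Integrable (fun ω => ∑ i, ‖X ω i‖ ^ 2) μ :=
    integrable_finsetSum _ fun i _ => hXi i
  have hi3 : Integrable (fun ω => ∑ i, d i * ‖(U *ᵥ X ω) i - (F *ᵥ Y ω) i‖ ^ 2) μ :=
    integrable_finsetSum _ fun i _ => (hUF i).const_mul _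
  unfold gmi
  simp_rw [hT, receiverFun, Real.log_exp, hq]
  have hi4 := hi1.sub (integrable_const (∑ i, Real.log (d i)))
  have hi5 := (hi2.sub hi3).add hi1
  have h4 := expectation_coe _ _ hi4
  have h5 := expectation_coe _ _ hi5
  simp only [Pi.sub_apply, Pi.add_apply] at h4 h5
  rw [h4, h5, ← EReal.coe_neg, ← EReal.coe_add]
  congr 1
  have h6 := integral_add (hi2.sub hi3) hi1
  simp only [Pi.sub_apply] at h6
  rw [integral_sub hi1 (integrable_const _), h6, integral_sub hi2 hi3,
    integral_finsetSum _ fun i _ => hXi i,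
    integral_finsetSum _ fun i _ => (hUF i).const_mul _]
  simp_rw [integral_const_mul, hX1]
  simp only [integral_const, probReal_univ, smul_eq_mul, one_mul, Finset.sum_add_distrib,
    Finset.sum_sub_distrib]
  ring

/-! ### Factorization of `1 + Gr` and completion of the square. -/

/-- An `LDL` factorization `A = Uᴴ D U` of a positive definite matrix, with `U` unit lower
triangular and vanishing wherever `A` is forced to vanish by a labelling of the indices. -/
theorem exists_ldl {n : ℕ} {L : Type*} (β : Fin n → L) (A : Matrix (Fin n) (Fin n) ℂ)
    (hA : A.IsHermitian) (hpos : ∀ v, v ≠ 0 → 0 < (star v ⬝ᵥ (A *ᵥ v)).re)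
    (hβ : ∀ i j, β i ≠ β j → A i j = 0) :
    ∃ (U : Matrix (Fin n) (Fin n) ℂ) (d : Fin n → ℝ), (∀ i, 0 < d i) ∧ (∀ i, U i i = 1) ∧
      (∀ i j, i < j → U i j = 0) ∧ (∀ i j, β i ≠ β j → U i j = 0) ∧
      A = Uᴴ * diagonal (fun i => (d i : ℂ)) * U := by
  induction n with
  | zero =>
    refine ⟨0, 0, fun i => i.elim0, fun i => i.elim0, fun i => i.elim0, fun i => i.elim0, ?_⟩
    ext i
    exact i.elim0
  | succ n ih =>
    have hAs : ∀ i j, star (A i j) = A j i := fun i j => hA.apply j i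
    obtain ⟨c, hc⟩ : ∃ c : ℝ, A (Fin.last n) (Fin.last n) = c := by
      refine ⟨(A (Fin.last n) (Fin.last n)).re, ?_⟩
      exact (Complex.conj_eq_iff_re.1 (hAs _ _)).symm
    have hc0 : 0 < c := by
      have h := hpos (Pi.single (Fin.last n) 1) (by simp)
      simpa [hc] using h
    have hcC : (c : ℂ) ≠ 0 := by exact_mod_cast hc0.ne'
    -- Elimination starts from the last index: `u` is the last row divided by the pivot and `S`
    -- below is the Schur complement. This order makes `U` lower triangular in `Uᴴ D U`, so that row
    -- `i` involves only symbols up to `i`.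
    let u : Fin n → ℂ := fun j => A (Fin.last n) j.castSucc / c
    have hu : ∀ j, A (Fin.last n) j.castSucc = c * u j := fun j => by simp only [u]; field_simp
    have hu' : ∀ j, A j.castSucc (Fin.last n) = c * star (u j) := fun j => by
      rw [← hAs, hu]; simp
    let S : Matrix (Fin n) (Fin n) ℂ := fun i j => A i.castSucc j.castSucc - star (u i) * c * u j
    obtain ⟨U, d, hd, hU1, hUt, hUβ, hS⟩ := ih (fun i => β i.castSucc) S
      (by
        ext i j
        change star (A j.castSucc i.castSucc - star (u j) * c * u i) =
          A i.castSucc j.castSucc - star (u i) * c * u j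
        have hcs : star (c : ℂ) = c := Complex.conj_ofReal c
        rw [star_sub, hAs, star_mul', star_mul', star_star, hcs]
        ring)
      (by
        intro v hv
        -- This last coordinate annihilates the pivot's square, so the form of `A` at `(v, t)`
        -- equals the form of `S` at `v`.
        let t : ℂ := -∑ j, u j * v j
        have hw := hpos (Fin.snoc v t) (by
          intro h
          refine hv (funext fun i => ?_)
          simpa using congrFun h i.castSucc)
        convert hw using 2
        have e1 : ∑ i, star (u i) * star (v i) = -star t := by simp [t]
        have e2 : ∑ j, u j * v j = -t := by simp [t]
        simp only [dotProduct, mulVec, Fin.sum_univ_castSucc, Pi.star_apply, Fin.snoc_castSucc,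
          Fin.snoc_last, hu, hu', hc, S]
        have e3 : ∀ i, ∑ j, (A i.castSucc j.castSucc - star (u i) * c * u j) * v j =
            ∑ j, A i.castSucc j.castSucc * v j + star (u i) * c * t := by
          intro i
          simp_rw [sub_mul, Finset.sum_sub_distrib, mul_assoc, ← Finset.mul_sum]
          rw [e2]; ring
        simp_rw [e3, mul_assoc, ← Finset.mul_sum, e2, mul_add, Finset.sum_add_distrib]
        have e4 : ∑ i, star (v i) * (c * (star (u i) * t)) = -(c * star t * t) := by
          rw [show -(c * star t * t) = (c * t) * (-star t) by ring, ← e1, Finset.mul_sum]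
          exact Finset.sum_congr rfl fun i _ => by ring
        have e5 : ∑ i, star (v i) * (star (u i) * (c * t)) = -(c * star t * t) := by
          rw [← e4]
          exact Finset.sum_congr rfl fun i _ => by ring
        rw [e4, e5]
        ring)
      (by
        intro i j hij
        simp only [S]
        rw [hβ _ _ hij, zero_sub, neg_eq_zero]
        -- The last index cannot share its label with both `i` and `j`, so `u i` or `u j` vanishes
        -- and the correction creates no fill-in across labels.
        by_cases h : β (Fin.last n) = β j.castSucc
        · have : β (Fin.last n) ≠ β i.castSucc := fun h' => hij (h'.symm.trans h)
          simp [u, hβ _ _ this]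
        · simp [u, hβ _ _ h])
    -- `U` bordered by the bottom row `(u, 1)` and a zero last column.
    let V : Matrix (Fin (n + 1)) (Fin (n + 1)) ℂ := fun i => Fin.lastCases
      (Fin.snoc u 1 : Fin (n + 1) → ℂ) (fun i => (Fin.snoc (U i) 0 : Fin (n + 1) → ℂ)) i
    have V1 : V (Fin.last n) = Fin.snoc u 1 := by simp [V]
    have V2 : ∀ i : Fin n, V i.castSucc = Fin.snoc (U i) 0 := by simp [V]
    refine ⟨V, Fin.snoc d c, ?_, ?_, ?_, ?_, ?_⟩
    · intro i
      refine Fin.lastCases ?_ (fun i => ?_) i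
      · simpa using hc0
      · simpa using hd i
    · intro i
      refine Fin.lastCases ?_ (fun i => ?_) i
      · simp [V1]
      · simp [V2, hU1]
    · intro i j
      refine Fin.lastCases ?_ (fun i => ?_) i
      · intro h
        exact absurd h (not_lt.2 (Fin.le_last j))
      · refine Fin.lastCases ?_ (fun j => ?_) j
        · simp [V2]
        · intro h
          simpa [V2] using hUt i j h
    · intro i j
      refine Fin.lastCases ?_ (fun i => ?_) i <;> refine Fin.lastCases ?_ (fun j => ?_) j
      · simp
      · intro h
        simp [V1, u, hβ _ _ h]
      · simp [V2]
      · intro h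
        simpa [V2] using hUβ i j h
    · have hent : ∀ i j, (Vᴴ * diagonal (fun i => ((Fin.snoc d c : Fin (n + 1) → ℝ) i : ℂ)) * V) i j
          = ∑ k, star (V k i) * ((Fin.snoc d c : Fin (n + 1) → ℝ) k : ℂ) * V k j := by
        intro i j
        rw [Matrix.mul_apply]
        simp_rw [mul_diagonal, conjTranspose_apply]
      have hent' : ∀ i j, S i j = ∑ k, star (U k i) * (d k : ℂ) * U k j := by
        intro i j
        rw [hS, Matrix.mul_apply]
        simp_rw [mul_diagonal, conjTranspose_apply]
      ext i j
      rw [hent, Fin.sum_univ_castSucc]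
      refine Fin.lastCases ?_ (fun i => ?_) i <;> refine Fin.lastCases ?_ (fun j => ?_) j
      · simp [V1, V2, hc]
      · simp [V1, V2, hu]
      · simp only [V1, V2, hu', Fin.snoc_castSucc, Fin.snoc_last, mul_zero, Finset.sum_const_zero]
        ring
      · simp only [V1, V2, Fin.snoc_castSucc, Fin.snoc_last]
        rw [← hent']
        simp only [S]
        ring

theorem det_eq_one_of_unit_lowerTriangular {n : ℕ} {U : Matrix (Fin n) (Fin n) ℂ}
    (h1 : ∀ i, U i i = 1) (ht : ∀ i j, i < j → U i j = 0) : U.det = 1 := by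
  rw [det_of_isLowerTriangular U fun i j hij => ht i j hij]
  simp [h1]

theorem dotProduct_conjTranspose_mul_diagonal {n m k : ℕ} (U : Matrix (Fin n) (Fin m) ℂ)
    (W : Matrix (Fin n) (Fin k) ℂ) (d : Fin n → ℝ) (x : Fin m → ℂ) (y : Fin k → ℂ) :
    star x ⬝ᵥ ((Uᴴ * diagonal (fun i => (d i : ℂ)) * W) *ᵥ y) =
      ∑ i, (d i : ℂ) * (star ((U *ᵥ x) i) * (W *ᵥ y) i) := by
  rw [← mulVec_mulVec, ← mulVec_mulVec, dotProduct_mulVec, ← star_mulVec, dotProduct]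
  refine Finset.sum_congr rfl fun i _ => ?_
  rw [mulVec_diagonal, Pi.star_apply]
  ring

/-- Completion of the square in the exponent of the receiver function. -/
theorem receiver_exponent_eq {n nR : ℕ} (U : Matrix (Fin n) (Fin n) ℂ)
    (F : Matrix (Fin n) (Fin nR) ℂ) (d : Fin n → ℝ) (x : Fin n → ℂ) (y : Fin nR → ℂ) :
    2 * (star x ⬝ᵥ ((Uᴴ * diagonal (fun i => (d i : ℂ)) * F) *ᵥ y)).re -
      (star x ⬝ᵥ ((Uᴴ * diagonal (fun i => (d i : ℂ)) * U - 1) *ᵥ x)).re =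
    ∑ i, ‖x i‖ ^ 2 - ∑ i, d i * ‖(U *ᵥ x) i - (F *ᵥ y) i‖ ^ 2 + ∑ i, d i * ‖(F *ᵥ y) i‖ ^ 2 := by
  rw [sub_mulVec, one_mulVec, dotProduct_sub, dotProduct_conjTranspose_mul_diagonal,
    dotProduct_conjTranspose_mul_diagonal, dotProduct]
  simp only [Complex.sub_re, Complex.re_sum, Complex.re_ofReal_mul]
  rw [Finset.mul_sum, ← Finset.sum_sub_distrib, ← Finset.sum_sub_distrib,
    ← Finset.sum_sub_distrib, ← Finset.sum_add_distrib]
  refine Finset.sum_congr rfl fun i _ => ?_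
  simp only [← Complex.normSq_eq_norm_sq, Complex.normSq_apply, Complex.mul_re, Pi.star_apply,
    RCLike.star_def, Complex.conj_re, Complex.conj_im, Complex.sub_re, Complex.sub_im]
  ring

/-! ### Linear forms of a complex Gaussian vector. -/

/-- Every real functional is the real part of a complex one. Hence `IsStdComplexGaussian`, which
tests complex coefficients only, controls the whole real dual. -/
theorem exists_eq_re_mul (l : ℂ →ₗ[ℝ] ℝ) : ∃ c : ℂ, ∀ z, l z = (c * z).re := by
  refine ⟨⟨l 1, -l Complex.I⟩, fun z => ?_⟩
  have hz : z = z.re • (1 : ℂ) + z.im • Complex.I := by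
    apply Complex.ext <;> simp
  conv_lhs => rw [hz]
  rw [map_add, map_smul, map_smul]
  simp only [smul_eq_mul, Complex.mul_re]
  ring

theorem exists_eq_re_dotProduct {J : Type*} [Fintype J] [DecidableEq J] (l : (J → ℂ) →ₗ[ℝ] ℝ) :
    ∃ c : J → ℂ, ∀ z, l z = (∑ j, c j * z j).re := by
  choose c hc using fun j => exists_eq_re_mul (l ∘ₗ LinearMap.single ℝ (fun _ : J => ℂ) j)
  refine ⟨c, fun z => ?_⟩
  rw [Complex.re_sum]
  simp_rw [← hc]
  conv_lhs => rw [← Finset.univ_sum_single z, map_sum]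
  rfl

section LinearForms

variable {Ω ι : Type*} [Fintype ι]

/-- A linear form of a standard circularly-symmetric complex Gaussian vector. -/
def form (V : Ω → ι → ℂ) (a : ι → ℂ) (ω : Ω) : ℂ := ∑ i, a i * V ω i



theorem form_add (V : Ω → ι → ℂ) (a b : ι → ℂ) (ω : Ω) :
    form V (a + b) ω = form V a ω + form V b ω := by
  simp [form, add_mul, Finset.sum_add_distrib]

theorem form_sub (V : Ω → ι → ℂ) (a b : ι → ℂ) (ω : Ω) :
    form V (a - b) ω = form V a ω - form V b ω := by
  simp [form, sub_mul, Finset.sum_sub_distrib]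

theorem form_smul (V : Ω → ι → ℂ) (c : ℂ) (a : ι → ℂ) (ω : Ω) :
    form V (c • a) ω = c * form V a ω := by
  simp [form, Finset.mul_sum, mul_assoc]

theorem form_sum {J : Type*} (s : Finset J) (V : Ω → ι → ℂ) (b : J → ι → ℂ) (ω : Ω) :
    form V (∑ j ∈ s, b j) ω = ∑ j ∈ s, form V (b j) ω := by
  classical
  induction s using Finset.induction_on with
  | empty => simp [form]
  | insert j s hj ih => rw [Finset.sum_insert hj, Finset.sum_insert hj, form_add, ih]

variable [MeasurableSpace Ω] {μ : Measure Ω} {V : Ω → ι → ℂ}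

theorem measurable_form (hV : Measurable V) (a : ι → ℂ) : Measurable (form V a) := by
  unfold form
  exact Finset.measurable_sum _ fun i _ => (((measurable_pi_apply i).comp hV).const_mul _)

/-- `V` has the characteristic function of a standard circularly-symmetric complex Gaussian
vector. -/
def IsStdComplexGaussian (V : Ω → ι → ℂ) (μ : Measure Ω) : Prop :=
  ∀ a : ι → ℂ, ∫ ω, Complex.exp ((form V a ω).re * Complex.I) ∂μ =
    Complex.exp (-((∑ i, ‖a i‖ ^ 2) / 4 : ℝ))

variable [IsProbabilityMeasure μ]

/-- The characteristic functions agree: the frequency `t` is absorbed into the coefficients as `star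
t • a`. -/
theorem IsStdComplexGaussian.map_form (h : IsStdComplexGaussian V μ) (hV : Measurable V)
    (a : ι → ℂ) : μ.map (form V a) = complexGaussian (∑ i, ‖a i‖ ^ 2) := by
  have hm := measurable_form hV a
  have := Measure.isProbabilityMeasure_map (μ := μ) hm.aemeasurable
  apply Measure.ext_of_charFun
  ext t
  have hin : ∀ x : ℂ, inner ℝ x t = (star t * x).re := by
    intro x
    rw [Complex.inner]
    simp [Complex.mul_re]
  rw [charFun_apply, charFun_apply]
  simp_rw [hin]
  rw [integral_complexGaussian_exp (Finset.sum_nonneg fun i _ => by positivity),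
    integral_map hm.aemeasurable (by fun_prop)]
  simp_rw [← form_smul]
  rw [h]
  congr 3
  simp only [Pi.smul_apply, norm_smul, norm_star, mul_pow, ← Finset.mul_sum]
  ring

theorem IsStdComplexGaussian.integrable_sq (h : IsStdComplexGaussian V μ) (hV : Measurable V)
    (a : ι → ℂ) : Integrable (fun ω => ‖form V a ω‖ ^ 2) μ := by
  have hi := integrable_complexGaussian_sq (∑ i, ‖a i‖ ^ 2)
  rw [← h.map_form hV a] at hi
  exact hi.comp_measurable (measurable_form hV a)

theorem IsStdComplexGaussian.integral_sq (h : IsStdComplexGaussian V μ) (hV : Measurable V)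
    (a : ι → ℂ) : ∫ ω, ‖form V a ω‖ ^ 2 ∂μ = ∑ i, ‖a i‖ ^ 2 := by
  have hi := integral_complexGaussian_sq (v := ∑ i, ‖a i‖ ^ 2)
    (Finset.sum_nonneg fun i _ => by positivity)
  rwa [← h.map_form hV a, integral_map (measurable_form hV a).aemeasurable (by fun_prop)] at hi

theorem sum_norm_add_sq (a b : ι → ℂ) (h : ∑ i, star (b i) * a i = 0) :
    ∑ i, ‖(b + a) i‖ ^ 2 = ∑ i, ‖b i‖ ^ 2 + ∑ i, ‖a i‖ ^ 2 := by
  have h' := congrArg Complex.re h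
  rw [Complex.re_sum] at h'
  rw [← Finset.sum_add_distrib, ← sub_eq_zero, ← Finset.sum_sub_distrib]
  calc _ = ∑ i, 2 * (star (b i) * a i).re := by
        refine Finset.sum_congr rfl fun i _ => ?_
        simp only [← Complex.normSq_eq_norm_sq, Complex.normSq_apply, Pi.add_apply, Complex.add_re,
          Complex.add_im, Complex.mul_re, RCLike.star_def, Complex.conj_re, Complex.conj_im]
        ring
    _ = 0 := by rw [← Finset.mul_sum, h']; simp

/-- Uncorrelated linear forms of a circularly-symmetric Gaussian vector are independent. -/
theorem IsStdComplexGaussian.indepFun (h : IsStdComplexGaussian V μ) (hV : Measurable V)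
    {J : Type*} [Fintype J] [DecidableEq J] (b : J → ι → ℂ) (a : ι → ℂ)
    (hab : ∀ j, ∑ i, star (b j i) * a i = 0) :
    IndepFun (fun ω j => form V (b j) ω) (form V a) μ := by
  have hW : Measurable fun ω j => form V (b j) ω :=
    measurable_pi_lambda _ fun j => measurable_form hV _
  have hm := measurable_form hV a
  rw [indepFun_iff_charFunDual_prod hW.aemeasurable hm.aemeasurable]
  intro L
  obtain ⟨d, hd⟩ := exists_eq_re_dotProduct
    ((L.comp (.inl ℝ (J → ℂ) ℂ) : (J → ℂ) →L[ℝ] ℝ) : (J → ℂ) →ₗ[ℝ] ℝ)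
  obtain ⟨c, hc⟩ := exists_eq_re_mul
    ((L.comp (.inr ℝ (J → ℂ) ℂ) : ℂ →L[ℝ] ℝ) : ℂ →ₗ[ℝ] ℝ)
  have hd' : ∀ z, L (z, 0) = (∑ j, d j * z j).re := fun z => hd z
  have hc' : ∀ z, L (0, z) = (c * z).re := fun z => hc z
  have hL : ∀ w z, L (w, z) = (∑ j, d j * w j).re + (c * z).re := by
    intro w z
    rw [← hd', ← hc', ← map_add]
    simp
  -- Orthogonality survives linear combination, so the squared norms add and the joint
  -- characteristic function factorizes.
  have hcd : ∑ i, star ((∑ j, d j • b j) i) * (c • a) i = 0 := by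
    simp only [Finset.sum_apply, Pi.smul_apply, smul_eq_mul, star_sum, Finset.sum_mul, star_mul']
    rw [Finset.sum_comm]
    refine Finset.sum_eq_zero fun j _ => ?_
    calc _ = (star (d j) * c) * ∑ i, star (b j i) * a i := by
          rw [Finset.mul_sum]
          exact Finset.sum_congr rfl fun i _ => by ring
      _ = 0 := by rw [hab, mul_zero]
  simp only [charFunDual_apply, ContinuousLinearMap.comp_apply, ContinuousLinearMap.inl_apply,
    ContinuousLinearMap.inr_apply]
  rw [integral_map (hW.prodMk hm).aemeasurable (by fun_prop),
    integral_map hW.aemeasurable (by fun_prop), integral_map hm.aemeasurable (by fun_prop)]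
  simp only [hd', hc']
  simp only [hL]
  simp_rw [← Complex.add_re, ← form_smul, ← form_sum, ← form_add]
  rw [h, h, h, ← Complex.exp_add, sum_norm_add_sq _ _ hcd]
  congr 1
  push_cast
  ring

end LinearForms

/-- Normalizing the noise makes `(X, N / √N₀)` a single standard vector, so every variable of the
channel becomes a linear form and covariances become inner products of coefficients. -/
theorem isStdComplexGaussian_sumElim {Ω : Type*} [MeasurableSpace Ω] {μ : Measure Ω}
    [IsProbabilityMeasure μ] {nR nT : ℕ} {N₀ : ℝ} (hN₀ : 0 < N₀)
    {X : Ω → Fin nT → ℂ} {N : Ω → Fin nR → ℂ} (hX : Measurable X) (hN : Measurable N)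
    (hXlaw : μ.map X = complexGaussianVec nT 1) (hNlaw : μ.map N = complexGaussianVec nR N₀)
    (hXN : IndepFun X N μ) :
    IsStdComplexGaussian (fun ω => Sum.elim (X ω) (fun i => ((√N₀)⁻¹ : ℝ) * N ω i)) μ := by
  intro a
  have key : ∀ (n : ℕ) (v : ℝ) (hv : 0 ≤ v) (Z : Ω → Fin n → ℂ) (hZ : Measurable Z)
      (hl : μ.map Z = complexGaussianVec n v) (c : Fin n → ℂ),
      ∫ ω, Complex.exp ((∑ i, c i * Z ω i).re * Complex.I) ∂μ =
        Complex.exp (-((v * ∑ i, ‖c i‖ ^ 2) / 4 : ℝ)) := by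
    intro n v hv Z hZ hl c
    have h1 := integral_map (μ := μ) hZ.aemeasurable (f := fun z : Fin n → ℂ =>
      Complex.exp ((∑ i, c i * z i).re * Complex.I))
      (by exact Measurable.aestronglyMeasurable (by fun_prop))
    rw [← h1, hl]
    simp_rw [Complex.re_sum, Complex.ofReal_sum, Finset.sum_mul, Complex.exp_sum]
    unfold complexGaussianVec
    rw [integral_fintype_prod_eq_prod (𝕜 := ℂ)
      (f := fun i z => Complex.exp ((c i * z).re * Complex.I))]
    simp_rw [integral_complexGaussian_exp hv]
    rw [← Complex.exp_sum]
    congr 1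
    push_cast
    rw [Finset.mul_sum, Finset.sum_div, ← Finset.sum_neg_distrib]
  have hind := hXN.comp
    (φ := fun x : Fin nT → ℂ => Complex.exp ((∑ i, a (.inl i) * x i).re * Complex.I))
    (ψ := fun x : Fin nR → ℂ =>
      Complex.exp ((∑ i, (a (.inr i) * ((√N₀)⁻¹ : ℝ)) * x i).re * Complex.I))
    (by fun_prop) (by fun_prop)
  have hprod := hind.integral_fun_mul_eq_mul_integral
    (by exact (Measurable.comp (by fun_prop) hX).aestronglyMeasurable)
    (by exact (Measurable.comp (by fun_prop) hN).aestronglyMeasurable)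
  simp only [Function.comp_apply] at hprod
  rw [key nT 1 zero_le_one X hX hXlaw, key nR N₀ hN₀.le N hN hNlaw] at hprod
  convert hprod using 1
  · refine integral_congr_ae (Filter.Eventually.of_forall fun ω => ?_)
    simp only [form, Fintype.sum_sum_type, Sum.elim_inl, Sum.elim_inr]
    rw [← Complex.exp_add, ← add_mul, Complex.add_re, Complex.ofReal_add]
    simp_rw [mul_assoc]
  · rw [← Complex.exp_add]
    congr 1
    have h2 : ∀ i : Fin nR, ‖a (.inr i) * ((√N₀)⁻¹ : ℝ)‖ ^ 2 = N₀⁻¹ * ‖a (.inr i)‖ ^ 2 := by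
      intro i
      rw [norm_mul, mul_pow, Complex.norm_real, norm_inv, inv_pow, Real.norm_eq_abs, sq_abs,
        Real.sq_sqrt hN₀.le, mul_comm]
    simp_rw [h2, ← Finset.mul_sum, Fintype.sum_sum_type]
    rw [mul_inv_cancel_left₀ hN₀.ne']
    push_cast
    ring

/-! ### Conditional mutual information from an independent innovation. -/

/-- The log-likelihood ratio of `CN(m, s)` with respect to `CN(0, 1)` at `b`. -/
def logRatio (s : ℝ) (m b : ℂ) : ℝ := -Real.log s - ‖b - m‖ ^ 2 / s + ‖b‖ ^ 2

theorem exp_logRatio_mul_pdf {s : ℝ} (hs : 0 < s) (m b : ℂ) :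
    ENNReal.ofReal (Real.exp (logRatio s m b)) * complexGaussianPDF 1 b =
      complexGaussianPDF s (b - m) := by
  unfold complexGaussianPDF logRatio
  rw [← ENNReal.ofReal_mul (Real.exp_pos _).le]
  congr 1
  rw [sub_eq_add_neg, Real.exp_add, Real.exp_add, Real.exp_neg (Real.log s), Real.exp_log hs,
    mul_one, div_one, Real.exp_neg (‖b‖ ^ 2), mul_inv]
  have := (Real.exp_pos (‖b‖ ^ 2)).ne'
  field_simp

theorem lintegral_add_complexGaussian {s : ℝ} (hs : 0 < s) (m : ℂ) (f : ℂ → ℝ≥0∞)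
    (hf : Measurable f) :
    ∫⁻ e, f (m + e) ∂(complexGaussian s) =
      ∫⁻ b, ENNReal.ofReal (Real.exp (logRatio s m b)) * f b ∂(complexGaussian 1) := by
  have hr : Measurable fun b => ENNReal.ofReal (Real.exp (logRatio s m b)) := by
    unfold logRatio; fun_prop
  have hfm : Measurable fun e => f (m + e) := hf.comp (by fun_prop)
  have hrf : Measurable fun b => ENNReal.ofReal (Real.exp (logRatio s m b)) * f b := hr.mul hf
  rw [complexGaussian_eq_withDensity hs, complexGaussian_eq_withDensity one_pos,
    lintegral_withDensity_eq_lintegral_mul _ (measurable_complexGaussianPDF s) hfm,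
    lintegral_withDensity_eq_lintegral_mul _ (measurable_complexGaussianPDF 1) hrf,
    ← lintegral_sub_right_eq_self _ m]
  refine lintegral_congr fun b => ?_
  simp only [Pi.mul_apply, add_sub_cancel]
  rw [← exp_logRatio_mul_pdf hs]
  ring

/-- Given `(Z, A)`, `B` has law `CN(w, s)`, while given `Z` alone it is `CN(0, 1)`. The divergence
is therefore the mean of `logRatio`, namely `-log s - E|e|² / s + E|B|² = -log s - 1 + 1`. -/
theorem condMutualInfo_eq_of_innovation {Ω α γ : Type*} [MeasurableSpace Ω] [MeasurableSpace α]
    [StandardBorelSpace α] [Nonempty α] [MeasurableSpace γ] (μ : Measure Ω)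
    [IsProbabilityMeasure μ] {A : Ω → α} {B e : Ω → ℂ} {Z : Ω → γ} (hA : Measurable A)
    (he : Measurable e) (hZ : Measurable Z) (w : γ × α → ℂ) (hw : Measurable w)
    (hB : ∀ ω, B ω = w (Z ω, A ω) + e ω)
    (hind : IndepFun (fun ω => (Z ω, A ω)) e μ) {s : ℝ} (hs : 0 < s)
    (hlaw : μ.map e = complexGaussian s) (hBlaw : μ.map B = complexGaussian 1)
    (hZB : IndepFun Z B μ) :
    condMutualInfo μ A B Z = ENNReal.ofReal (-Real.log s) := by
  have hBm : Measurable B := by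
    rw [show B = fun ω => w (Z ω, A ω) + e ω from funext hB]
    exact (hw.comp (hZ.prodMk hA)).add he
  have hJ : Measurable fun ω => (Z ω, (A ω, B ω)) := hZ.prodMk (hA.prodMk hBm)
  have := Measure.isProbabilityMeasure_map (μ := μ) hZ.aemeasurable
  have := Measure.isProbabilityMeasure_map (μ := μ) hJ.aemeasurable
  have := Measure.isProbabilityMeasure_map (μ := μ) (hZ.prodMk hA).aemeasurable
  unfold condMutualInfo
  have hcond : condDistrib B Z μ =ᵐ[μ.map Z] Kernel.const γ (complexGaussian 1) := by
    refine condDistrib_ae_eq_of_measure_eq_compProd Z hBm.aemeasurable ?_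
    rw [Measure.compProd_const, (indepFun_iff_map_prod_eq_prod_map_map hZ.aemeasurable
      hBm.aemeasurable).1 hZB, hBlaw]
  have href : μ.map Z ⊗ₘ (condDistrib A Z μ ×ₖ condDistrib B Z μ) =
      μ.map Z ⊗ₘ (condDistrib A Z μ ×ₖ Kernel.const γ (complexGaussian 1)) := by
    refine Measure.compProd_congr ?_
    filter_upwards [hcond] with z hz
    rw [Kernel.prod_apply, Kernel.prod_apply, hz]
  rw [href]
  set ref := μ.map Z ⊗ₘ (condDistrib A Z μ ×ₖ Kernel.const γ (complexGaussian 1)) with href_def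
  -- Under the reference measure, `(Z, A)` keeps its joint law and `B` is replaced by an independent
  -- `CN(0, 1)` variable.
  have hlin : ∀ f : γ × (α × ℂ) → ℝ≥0∞, Measurable f → ∫⁻ p, f p ∂ref =
      ∫⁻ q, ∫⁻ b, f (q.1, (q.2, b)) ∂(complexGaussian 1) ∂(μ.map fun ω => (Z ω, A ω)) := by
    intro f hf
    have hf2 : Measurable fun q : γ × α => ∫⁻ b, f (q.1, (q.2, b)) ∂(complexGaussian 1) :=
      Measurable.lintegral_prod_right' (f := fun r : (γ × α) × ℂ => f (r.1.1, (r.1.2, r.2)))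
        (hf.comp (by fun_prop))
    rw [← compProd_map_condDistrib hA.aemeasurable, Measure.lintegral_compProd hf2,
      href_def, Measure.lintegral_compProd hf]
    refine lintegral_congr fun z => ?_
    rw [Kernel.prod_apply, lintegral_prod _ (by fun_prop)]
    simp
  let g : γ × (α × ℂ) → ℝ := fun p => logRatio s (w (p.1, p.2.1)) p.2.2
  have hg : Measurable g := by
    simp only [g, logRatio]; fun_prop
  have hD : μ.map (fun ω => (Z ω, (A ω, B ω))) =
      ref.withDensity fun p => ENNReal.ofReal (Real.exp (g p)) := by
    have hgm : Measurable fun p => ENNReal.ofReal (Real.exp (g p)) := by fun_prop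
    refine Measure.ext_of_lintegral _ fun f hf => ?_
    rw [lintegral_withDensity_eq_lintegral_mul _ hgm hf, hlin _ (hgm.mul hf),
      lintegral_map hf hJ]
    have h1 := (indepFun_iff_map_prod_eq_prod_map_map (hZ.prodMk hA).aemeasurable
      he.aemeasurable).1 hind
    have hf3 : Measurable fun r : (γ × α) × ℂ => f (r.1.1, (r.1.2, w r.1 + r.2)) :=
      hf.comp (by fun_prop)
    have h2 := lintegral_map hf3 ((hZ.prodMk hA).prodMk he) (μ := μ)
    simp_rw [hB]
    rw [← h2, h1, lintegral_prod _ hf3.aemeasurable, hlaw]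
    refine lintegral_congr fun q => ?_
    rw [lintegral_add_complexGaussian hs (w q) (fun b => f (q.1, (q.2, b)))
      (hf.comp (by fun_prop))]
    rfl
  have hac : μ.map (fun ω => (Z ω, (A ω, B ω))) ≪ ref := by
    rw [hD]; exact withDensity_absolutelyContinuous _ _
  have hrn : (μ.map (fun ω => (Z ω, (A ω, B ω)))).rnDeriv ref =ᵐ[ref]
      fun p => ENNReal.ofReal (Real.exp (g p)) := by
    rw [hD]; exact Measure.rnDeriv_withDensity _ (by fun_prop)
  have hllr : llr (μ.map (fun ω => (Z ω, (A ω, B ω)))) ref =ᵐ[μ.map fun ω => (Z ω, (A ω, B ω))]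
      g := by
    filter_upwards [hac.ae_le hrn] with p hp
    rw [llr, hp, ENNReal.toReal_ofReal (Real.exp_pos _).le, Real.log_exp]
  -- Along the sample `B - w` is the innovation `e`, so only the second moments of `e` and `B` are
  -- needed.
  have hgc : (g ∘ fun ω => (Z ω, (A ω, B ω))) =
      fun ω => -Real.log s - ‖e ω‖ ^ 2 / s + ‖B ω‖ ^ 2 := by
    ext ω
    simp only [g, logRatio, Function.comp_apply]
    rw [hB, add_sub_cancel_left]
  have hie : Integrable (fun ω => ‖e ω‖ ^ 2) μ := by
    have := integrable_complexGaussian_sq s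
    rw [← hlaw] at this
    exact this.comp_measurable he
  have hiB : Integrable (fun ω => ‖B ω‖ ^ 2) μ := by
    have := integrable_complexGaussian_sq 1
    rw [← hBlaw] at this
    exact this.comp_measurable hBm
  have he2 : ∫ ω, ‖e ω‖ ^ 2 ∂μ = s := by
    have := integral_complexGaussian_sq hs.le
    rwa [← hlaw, integral_map he.aemeasurable (by fun_prop)] at this
  have hB2 : ∫ ω, ‖B ω‖ ^ 2 ∂μ = 1 := by
    have := integral_complexGaussian_sq zero_le_one
    rwa [← hBlaw, integral_map hBm.aemeasurable (by fun_prop)] at this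
  have hi1 := (integrable_const (μ := μ) (-Real.log s)).sub (hie.div_const s)
  have hgi : Integrable g (μ.map fun ω => (Z ω, (A ω, B ω))) := by
    rw [integrable_map_measure hg.aestronglyMeasurable hJ.aemeasurable, hgc]
    exact hi1.add hiB
  rw [klDiv_of_ac_of_integrable hac (hgi.congr hllr.symm), integral_congr_ae hllr,
    integral_map hJ.aemeasurable hg.aestronglyMeasurable]
  have h3 := integral_add hi1 hiB
  have h4 := integral_sub (integrable_const (μ := μ) (-Real.log s)) (hie.div_const s)
  simp only [Pi.sub_apply] at h3
  have h5 : ∫ ω, g (Z ω, (A ω, B ω)) ∂μ = -Real.log s := by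
    have : ∀ ω, g (Z ω, (A ω, B ω)) = -Real.log s - ‖e ω‖ ^ 2 / s + ‖B ω‖ ^ 2 :=
      fun ω => congrFun hgc ω
    simp_rw [this]
    rw [h3, h4, integral_div, he2, hB2, div_self hs.ne']
    simp
  rw [h5]
  simp

/-! ### Orthogonal projection and successive linear MMSE estimation. -/

section Projection

variable {ι J : Type*} [Fintype ι] [Fintype J]

/-- Orthogonal projection in coordinates: some linear combination of the `b j` makes the residual
orthogonal to all `b j`. -/
theorem exists_residual_orthogonal (b : J → ι → ℂ) (x : ι → ℂ) :
    ∃ c : J → ℂ, ∀ j, ∑ i, star (b j i) * (x - ∑ j, c j • b j) i = 0 := by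
  let S : Submodule ℂ (EuclideanSpace ℂ ι) :=
    Submodule.span ℂ (Set.range fun j => WithLp.toLp 2 (b j))
  obtain ⟨c, hc⟩ := (Submodule.mem_span_range_iff_exists_fun ℂ).1
    (S.starProjection_apply_mem (WithLp.toLp 2 x))
  refine ⟨c, fun j => ?_⟩
  have h := (S.sub_starProjection_mem_orthogonal (WithLp.toLp 2 x))
    (WithLp.toLp 2 (b j)) (Submodule.subset_span ⟨j, rfl⟩)
  rw [← hc, PiLp.inner_apply] at h
  rw [← h]
  refine Finset.sum_congr rfl fun i _ => ?_
  simp [mul_comm]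

/-- Pythagoras: the residual `a` is the shortest vector of its coset modulo the span of the `b j`.
-/
theorem sum_sq_le_of_residual_orthogonal (b : J → ι → ℂ) (a : ι → ℂ)
    (ha : ∀ j, ∑ i, star (b j i) * a i = 0) (c : J → ℂ) :
    ∑ i, ‖a i‖ ^ 2 ≤ ∑ i, ‖((∑ j, c j • b j) + a) i‖ ^ 2 := by
  rw [sum_norm_add_sq]
  · exact le_add_of_nonneg_left (Finset.sum_nonneg fun i _ => by positivity)
  · simp only [Finset.sum_apply, Pi.smul_apply, smul_eq_mul, star_sum, Finset.sum_mul, star_mul']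
    rw [Finset.sum_comm]
    refine Finset.sum_eq_zero fun j _ => ?_
    rw [← mul_zero (star (c j)), ← ha j, Finset.mul_sum]
    exact Finset.sum_congr rfl fun i _ => by ring

end Projection

section ErrorCoefficients

variable {nR nT : ℕ}

/-- The coefficients of `X i` as a linear form of `(X, N / √N₀)`. -/
def inputCoeff (nR : ℕ) (i : Fin nT) : Fin nT ⊕ Fin nR → ℂ := Pi.single (.inl i) 1

/-- The coefficients of `Y r` as a linear form of `(X, N / √N₀)`. -/
def outputCoeff (H : Matrix (Fin nR) (Fin nT) ℂ) (N₀ : ℝ) (r : Fin nR) : Fin nT ⊕ Fin nR → ℂ :=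
  Sum.elim (H r) (Pi.single r (√N₀ : ℂ))

/-- The coefficients of `(U X - F Y) i` as a linear form of `(X, N / √N₀)`. -/
def errorCoeff (H : Matrix (Fin nR) (Fin nT) ℂ) (N₀ : ℝ) (U : Matrix (Fin nT) (Fin nT) ℂ)
    (F : Matrix (Fin nT) (Fin nR) ℂ) (i : Fin nT) : Fin nT ⊕ Fin nR → ℂ :=
  ∑ j, U i j • inputCoeff nR j - ∑ r, F i r • outputCoeff H N₀ r

/-- Unit lower triangular matrices that vanish between indices with different labels. -/
def IsBlockUnitLower {L : Type*} (β : Fin nT → L) (U : Matrix (Fin nT) (Fin nT) ℂ) : Prop :=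
  (∀ i, U i i = 1) ∧ (∀ i j, i < j → U i j = 0) ∧ ∀ i j, β i ≠ β j → U i j = 0

/-- The noise coordinates, scaled by `√N₀ ≠ 0`, force row `i` of `F` to vanish, and then the
coefficient of `X i` is `1`. This makes every MMSE strictly positive. -/
theorem errorCoeff_ne_zero (H : Matrix (Fin nR) (Fin nT) ℂ) {N₀ : ℝ} (hN₀ : 0 < N₀)
    (U : Matrix (Fin nT) (Fin nT) ℂ) (F : Matrix (Fin nT) (Fin nR) ℂ) (i : Fin nT)
    (hU : U i i = 1) : errorCoeff H N₀ U F i ≠ 0 := by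
  intro h
  have hF : ∀ r, F i r = 0 := by
    intro r
    have := congrFun h (.inr r)
    simpa [errorCoeff, inputCoeff, outputCoeff, Pi.single_apply, hN₀.not_ge,
      Real.sqrt_eq_zero', Finset.sum_apply] using this
  have := congrFun h (.inl i)
  simp [errorCoeff, inputCoeff, Pi.single_apply, hF, hU, Finset.sum_apply] at this

/-- The successive linear MMSE errors of the inputs given the output and the earlier inputs with the
same label. -/
theorem exists_mmse {L : Type*} (H : Matrix (Fin nR) (Fin nT) ℂ) (N₀ : ℝ) (β : Fin nT → L) :
    ∃ (U : Matrix (Fin nT) (Fin nT) ℂ) (F : Matrix (Fin nT) (Fin nR) ℂ), IsBlockUnitLower β U ∧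
      (∀ i j, j < i → β j = β i →
        ∑ l, star (inputCoeff nR j l) * errorCoeff H N₀ U F i l = 0) ∧
      (∀ i r, ∑ l, star (outputCoeff H N₀ r l) * errorCoeff H N₀ U F i l = 0) ∧
      ∀ U' F', IsBlockUnitLower β U' → ∀ i,
        ∑ l, ‖errorCoeff H N₀ U F i l‖ ^ 2 ≤ ∑ l, ‖errorCoeff H N₀ U' F' i l‖ ^ 2 := by
  classical
  let P : Fin nT → Fin nT → Prop := fun i j => j < i ∧ β j = β i
  -- Inadmissible inputs are replaced by the zero vector, so all `i` share one index type. Their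
  -- projection coefficients are arbitrary, which is why `U` below masks them by `P`.
  let b : Fin nT → Fin nT ⊕ Fin nR → Fin nT ⊕ Fin nR → ℂ := fun i =>
    Sum.elim (fun j => if P i j then inputCoeff nR j else 0) (outputCoeff H N₀)
  choose c hc using fun i => exists_residual_orthogonal (b i) (inputCoeff nR i)
  let U : Matrix (Fin nT) (Fin nT) ℂ := fun i j =>
    (if i = j then 1 else 0) - if P i j then c i (.inl j) else 0
  let F : Matrix (Fin nT) (Fin nR) ℂ := fun i r => c i (.inr r)
  have hU : IsBlockUnitLower β U := by
    refine ⟨fun i => by simp [U, P], fun i j hij => ?_, fun i j hij => ?_⟩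
    · simp [U, P, hij.ne, hij.not_gt]
    · have h1 : i ≠ j := fun h => hij (h ▸ rfl)
      simp [U, P, h1, Ne.symm hij]
  have herr : ∀ i, errorCoeff H N₀ U F i = inputCoeff nR i - ∑ j, c i j • b i j := by
    intro i
    simp only [errorCoeff, U, F, b, Fintype.sum_sum_type, Sum.elim_inl, Sum.elim_inr, sub_smul,
      Finset.sum_sub_distrib, ite_smul, one_smul, zero_smul, smul_ite, smul_zero,
      Finset.sum_ite_eq, Finset.mem_univ, if_true]
    abel
  have horth : ∀ i j, ∑ l, star (b i j l) * errorCoeff H N₀ U F i l = 0 := by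
    intro i j
    rw [herr]
    exact hc i j
  refine ⟨U, F, hU, fun i j hij hβ => ?_, fun i r => horth i (.inr r), fun U' F' hU' i => ?_⟩
  · have := horth i (.inl j)
    simpa [b, P, hij, hβ] using this
  · let c' : Fin nT ⊕ Fin nR → ℂ := Sum.elim (fun j => -U' i j) (F' i)
    have h' : errorCoeff H N₀ U' F' i = (∑ j, (c i - c') j • b i j) + errorCoeff H N₀ U F i := by
      have h2 : ∑ j, U' i j • inputCoeff nR j =
          inputCoeff nR i + ∑ j, (if P i j then U' i j • inputCoeff nR j else 0) := by
        have : inputCoeff nR i = ∑ j, if i = j then inputCoeff nR j else 0 := by simp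
        conv_rhs => rw [this]
        rw [← Finset.sum_add_distrib]
        refine Finset.sum_congr rfl fun j _ => ?_
        rcases lt_trichotomy j i with h | h | h
        · by_cases hβ : β j = β i
          · simp [P, h, hβ, h.ne']
          · simp [P, hβ, h.ne', hU'.2.2 i j (Ne.symm hβ)]
        · subst h
          simp [P, hU'.1]
        · simp [P, h.ne, h.not_gt, hU'.2.1 i j h]
      rw [herr, errorCoeff, h2]
      simp only [Pi.sub_apply, sub_smul, Finset.sum_sub_distrib]
      simp only [c', b, Fintype.sum_sum_type, Sum.elim_inl, Sum.elim_inr, smul_ite, smul_zero,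
        neg_smul]
      have h3 : ∑ j, (if P i j then -(U' i j • inputCoeff nR j) else 0) =
          -∑ j, (if P i j then U' i j • inputCoeff nR j else 0) := by
        rw [← Finset.sum_neg_distrib]
        exact Finset.sum_congr rfl fun j _ => by split_ifs <;> simp
      rw [h3]
      abel
    rw [h']
    exact sum_sq_le_of_residual_orthogonal (b i) _ (horth i) _

theorem sum_sq_inputCoeff (i : Fin nT) : ∑ l, ‖inputCoeff nR i l‖ ^ 2 = 1 := by
  rw [Finset.sum_eq_single (Sum.inl i)]
  · simp [inputCoeff]
  · intro l _ hl
    simp [inputCoeff, hl]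
  · simp

theorem errorCoeff_one_zero (H : Matrix (Fin nR) (Fin nT) ℂ) (N₀ : ℝ) (i : Fin nT) :
    errorCoeff H N₀ 1 0 i = inputCoeff nR i := by
  simp [errorCoeff, Matrix.one_apply]

end ErrorCoefficients

/-! ### Indexing by blocks. -/

section Blocks

variable {M n : ℕ} {K : Fin M → ℕ} (hK : ∑ m, K m = n)

theorem blockStart_add_le {m m' : Fin M} (h : m < m') :
    blockStart K m + K m ≤ blockStart K m' := by
  unfold blockStart
  rw [add_comm, ← Finset.sum_insert (by simp), Finset.Iio_insert]
  exact Finset.sum_le_sum_of_subset fun l hl =>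
    Finset.mem_Iio.2 ((Finset.mem_Iic.1 hl).trans_lt h)

theorem blockIdx_bijective :
    Function.Bijective fun p : Σ m, Fin (K m) => blockIdx hK p.1 p.2 := by
  rw [Fintype.bijective_iff_injective_and_card]
  refine ⟨?_, by simp [hK]⟩
  rintro ⟨m, k⟩ ⟨m', k'⟩ h
  have h' : blockStart K m + (k : ℕ) = blockStart K m' + (k' : ℕ) := congrArg Fin.val h
  rcases lt_trichotomy m m' with hm | hm | hm
  · have := blockStart_add_le (K := K) hm
    omega
  · subst hm
    have : k = k' := Fin.ext (by omega)
    rw [this]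
  · have := blockStart_add_le (K := K) hm
    omega

/-- Indices as pairs of a block and a position in it. -/
def blockEquiv : (Σ m, Fin (K m)) ≃ Fin n := Equiv.ofBijective _ (blockIdx_bijective hK)

/-- The block that contains an index. -/
def blockOf (i : Fin n) : Fin M := ((blockEquiv hK).symm i).1

theorem blockOf_blockIdx (m : Fin M) (k : Fin (K m)) : blockOf hK (blockIdx hK m k) = m := by
  have : blockIdx hK m k = blockEquiv hK ⟨m, k⟩ := rfl
  rw [blockOf, this, Equiv.symm_apply_apply]

theorem exists_blockIdx (i : Fin n) : ∃ k, blockIdx hK (blockOf hK i) k = i :=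
  ⟨((blockEquiv hK).symm i).2, (blockEquiv hK).apply_symm_apply i⟩

theorem isBlockDiagonal_iff (G : Matrix (Fin n) (Fin n) ℂ) :
    IsBlockDiagonal hK G ↔ ∀ i j, blockOf hK i ≠ blockOf hK j → G i j = 0 := by
  constructor
  · intro h i j hij
    obtain ⟨k, hk⟩ := exists_blockIdx hK i
    obtain ⟨l, hl⟩ := exists_blockIdx hK j
    rw [← hk, ← hl]
    exact h _ _ hij k l
  · intro h m m' hm k l
    exact h _ _ (by rwa [blockOf_blockIdx, blockOf_blockIdx])

theorem blockIdx_lt_iff (m : Fin M) (k l : Fin (K m)) :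
    blockIdx hK m k < blockIdx hK m l ↔ k < l := by
  simp [blockIdx]

theorem sum_sum_blockIdx {R : Type*} [AddCommMonoid R] (f : Fin n → R) :
    ∑ m, ∑ k, f (blockIdx hK m k) = ∑ i, f i := by
  rw [← (blockEquiv hK).sum_comp, Fintype.sum_sigma]
  rfl

end Blocks

theorem IsBlockUnitLower.det_eq_one {n : ℕ} {L : Type*} {β : Fin n → L}
    {U : Matrix (Fin n) (Fin n) ℂ} (hU : IsBlockUnitLower β U) : U.det = 1 :=
  det_eq_one_of_unit_lowerTriangular hU.1 hU.2.1

theorem isBlockUnitLower_one {n : ℕ} {L : Type*} (β : Fin n → L) :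
    IsBlockUnitLower β (1 : Matrix (Fin n) (Fin n) ℂ) :=
  ⟨fun i => one_apply_eq i, fun _ _ h => one_apply_ne h.ne,
    fun _ _ h => one_apply_ne fun h' => h (h' ▸ rfl)⟩

/-- Within block `m`, row `k` of a block unit lower triangular matrix only involves the symbols of
the block up to the `k`-th. -/
theorem IsBlockUnitLower.mulVec_blockIdx {M n : ℕ} {K : Fin M → ℕ} {hK : ∑ m, K m = n}
    {U : Matrix (Fin n) (Fin n) ℂ} (hU : IsBlockUnitLower (blockOf hK) U) (m : Fin M)
    (k : Fin (K m)) (x : Fin n → ℂ) :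
    (U *ᵥ x) (blockIdx hK m k) = x (blockIdx hK m k) + ∑ j : Fin (k : ℕ),
      U (blockIdx hK m k) (blockIdx hK m ⟨j, j.2.trans k.2⟩) *
        x (blockIdx hK m ⟨j, j.2.trans k.2⟩) := by
  set i := blockIdx hK m k with hi
  have hlt : ∀ j : Fin (k : ℕ), blockIdx hK m ⟨j, j.2.trans k.2⟩ < i := fun j =>
    (blockIdx_lt_iff hK m _ _).2 j.2
  -- With the diagonal term subtracted, the summand vanishes off the block's past, so the sum over
  -- the past extends to all indices.
  have hsum : ∑ j : Fin (k : ℕ), U i (blockIdx hK m ⟨j, j.2.trans k.2⟩) *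
      x (blockIdx hK m ⟨j, j.2.trans k.2⟩) = ∑ j, (U i j * x j - if i = j then x j else 0) := by
    refine Fintype.sum_of_injective (fun j : Fin (k : ℕ) => blockIdx hK m ⟨j, j.2.trans k.2⟩)
      ?_ _ _ ?_ ?_
    · intro j j' h
      have h' : blockStart K m + (j : ℕ) = blockStart K m + (j' : ℕ) := congrArg Fin.val h
      exact Fin.ext (by omega)
    · intro j hj
      rcases lt_trichotomy j i with h | h | h
      · by_cases hβ : blockOf hK i = blockOf hK j
        · exfalso
          obtain ⟨l, hl⟩ := exists_blockIdx hK j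
          rw [hi, blockOf_blockIdx] at hβ
          subst hβ
          rw [← hl] at h
          exact hj ⟨⟨l, (blockIdx_lt_iff hK _ _ _).1 h⟩, hl⟩
        · simp [hU.2.2 i j hβ, h.ne']
      · subst h
        simp [hU.1]
      · simp [hU.2.1 i j h, h.ne]
    · intro j
      simp [(hlt j).ne']
  rw [hsum, Finset.sum_sub_distrib]
  simp [mulVec, dotProduct]

/-! ### The channel variables as linear forms. -/

section Channel

variable {Ω : Type*} {nR nT M : ℕ} {K : Fin M → ℕ} {hK : ∑ m, K m = nT}
  {H : Matrix (Fin nR) (Fin nT) ℂ} {N₀ : ℝ}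
  {X : Ω → Fin nT → ℂ} {N : Ω → Fin nR → ℂ} {Y : Ω → Fin nR → ℂ}

/-- The normalized vector `(X, N / √N₀)`. -/
def source (N₀ : ℝ) (X : Ω → Fin nT → ℂ) (N : Ω → Fin nR → ℂ) (ω : Ω) : Fin nT ⊕ Fin nR → ℂ :=
  Sum.elim (X ω) (fun i => ((√N₀)⁻¹ : ℝ) * N ω i)



theorem form_inputCoeff (i : Fin nT) (ω : Ω) :
    form (source N₀ X N) (inputCoeff nR i) ω = X ω i := by
  simp [form, inputCoeff, source, Pi.single_apply]

theorem form_outputCoeff (hN₀ : 0 < N₀) (hY : ∀ ω, Y ω = H *ᵥ X ω + N ω) (r : Fin nR) (ω : Ω) :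
    form (source N₀ X N) (outputCoeff H N₀ r) ω = Y ω r := by
  have : (√N₀ : ℂ) ≠ 0 := by
    exact_mod_cast (Real.sqrt_pos.2 hN₀).ne'
  simp [form, outputCoeff, source, Pi.single_apply, hY, mulVec, dotProduct, this]

theorem form_errorCoeff (hN₀ : 0 < N₀) (hY : ∀ ω, Y ω = H *ᵥ X ω + N ω)
    (U : Matrix (Fin nT) (Fin nT) ℂ) (F : Matrix (Fin nT) (Fin nR) ℂ) (i : Fin nT) (ω : Ω) :
    form (source N₀ X N) (errorCoeff H N₀ U F i) ω = (U *ᵥ X ω) i - (F *ᵥ Y ω) i := by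
  rw [errorCoeff, form_sub, form_sum, form_sum]
  simp_rw [form_smul, form_inputCoeff, form_outputCoeff hN₀ hY]
  rfl

variable [MeasurableSpace Ω]

theorem measurable_source (hX : Measurable X) (hN : Measurable N) :
    Measurable (source N₀ X N) := by
  refine measurable_pi_lambda _ fun i => ?_
  rcases i with i | i
  · exact (measurable_pi_apply i).comp hX
  · exact ((measurable_pi_apply i).comp hN).const_mul _

variable {μ : Measure Ω} [IsProbabilityMeasure μ]

/-- The MMSE error is the innovation of `Xᵢ`: orthogonality to `Y` and to the block's past gives
independence, and its variance is the squared norm of its coefficients. -/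
theorem condMutualInfo_eq_neg_log (hN₀ : 0 < N₀) (hX : Measurable X) (hN : Measurable N)
    (hXlaw : μ.map X = complexGaussianVec nT 1) (hNlaw : μ.map N = complexGaussianVec nR N₀)
    (hXN : IndepFun X N μ) (hY : ∀ ω, Y ω = H *ᵥ X ω + N ω)
    {U : Matrix (Fin nT) (Fin nT) ℂ} {F : Matrix (Fin nT) (Fin nR) ℂ}
    (hU : IsBlockUnitLower (blockOf hK) U)
    (horthX : ∀ i j, j < i → blockOf hK j = blockOf hK i →
      ∑ l, star (inputCoeff nR j l) * errorCoeff H N₀ U F i l = 0)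
    (horthY : ∀ i r, ∑ l, star (outputCoeff H N₀ r l) * errorCoeff H N₀ U F i l = 0)
    (m : Fin M) (k : Fin (K m)) :
    condMutualInfo μ Y (fun ω => X ω (blockIdx hK m k)) (blockPast hK X m k) =
      ENNReal.ofReal (-Real.log (∑ l, ‖errorCoeff H N₀ U F (blockIdx hK m k) l‖ ^ 2)) := by
  have hstd : IsStdComplexGaussian (source N₀ X N) μ :=
    isStdComplexGaussian_sumElim hN₀ hX hN hXlaw hNlaw hXN
  have hV : Measurable (source N₀ X N) := measurable_source hX hN
  set i := blockIdx hK m k with hi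
  let p : Fin (k : ℕ) → Fin nT := fun j => blockIdx hK m ⟨j, j.2.trans k.2⟩
  have hp : ∀ j, p j < i := fun j => (blockIdx_lt_iff hK m _ _).2 j.2
  have hpβ : ∀ j, blockOf hK (p j) = blockOf hK i := fun j => by
    rw [hi, blockOf_blockIdx, blockOf_blockIdx]
  have hYm : Measurable Y := by
    have : Y = fun ω r => form (source N₀ X N) (outputCoeff H N₀ r) ω := by
      funext ω r
      rw [form_outputCoeff hN₀ hY]
    rw [this]
    exact measurable_pi_lambda _ fun r => measurable_form hV _
  have hXm : ∀ j, Measurable fun ω => X ω j := fun j => (measurable_pi_apply j).comp hX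
  have hZm : Measurable (blockPast hK X m k) := measurable_pi_lambda _ fun j => hXm _
  -- The predictor `w` is obtained by solving `e = (UX - FY)ᵢ` for `Xᵢ`, using the unit diagonal of
  -- `U`.
  refine condMutualInfo_eq_of_innovation μ hYm (measurable_form hV (errorCoeff H N₀ U F i)) hZm
    (fun q => (∑ r, F i r * q.2 r) - ∑ j, U i (p j) * q.1 j) (by fun_prop) ?_ ?_ ?_
    (hstd.map_form hV _) ?_ ?_
  · intro ω
    rw [form_errorCoeff hN₀ hY, hU.mulVec_blockIdx]
    simp only [mulVec, dotProduct, blockPast, p, ← hi]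
    ring
  · have hind := hstd.indepFun hV
      (Sum.elim (fun j => inputCoeff nR (p j)) (outputCoeff H N₀)) (errorCoeff H N₀ U F i)
      (by
        rintro (j | r)
        · exact horthX i (p j) (hp j) (hpβ j)
        · exact horthY i r)
    have hcomp := hind.comp (φ := fun w : Fin (k : ℕ) ⊕ Fin nR → ℂ =>
      ((fun j => w (.inl j), fun r => w (.inr r)) : (Fin (k : ℕ) → ℂ) × (Fin nR → ℂ)))
      (by fun_prop) measurable_id
    rw [Function.id_comp] at hcomp
    convert hcomp using 1
    funext ω
    refine Prod.ext (funext fun j => ?_) (funext fun r => ?_)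
    · exact (form_inputCoeff (p j) ω).symm
    · exact (form_outputCoeff hN₀ hY r ω).symm
  · have hne := errorCoeff_ne_zero H hN₀ U F i (hU.1 i)
    obtain ⟨l, hl⟩ := Function.ne_iff.1 hne
    exact Finset.sum_pos' (fun _ _ => by positivity)
      ⟨l, Finset.mem_univ l, by have := norm_pos_iff.2 hl; positivity⟩
  · have := hstd.map_form hV (inputCoeff nR i)
    rw [sum_sq_inputCoeff] at this
    rw [← this]
    congr 1
    funext ω
    exact (form_inputCoeff i ω).symm
  · have hind := hstd.indepFun hV (fun j => inputCoeff nR (p j)) (inputCoeff nR i)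
      (by
        intro j
        refine Finset.sum_eq_zero fun l _ => ?_
        rcases eq_or_ne l (.inl i) with rfl | hl
        · simp [inputCoeff, (hp j).ne']
        · simp [inputCoeff, hl])
    convert hind using 1
    · funext ω j
      exact (form_inputCoeff (p j) ω).symm
    · funext ω
      exact (form_inputCoeff i ω).symm

theorem gmi_eq_sum (hN₀ : 0 < N₀) (hX : Measurable X) (hN : Measurable N)
    (hXlaw : μ.map X = complexGaussianVec nT 1) (hNlaw : μ.map N = complexGaussianVec nR N₀)
    (hXN : IndepFun X N μ) (hY : ∀ ω, Y ω = H *ᵥ X ω + N ω)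
    (U : Matrix (Fin nT) (Fin nT) ℂ) (hU : U.det = 1) (F : Matrix (Fin nT) (Fin nR) ℂ)
    (d : Fin nT → ℝ) (hd : ∀ i, 0 < d i) :
    gmi μ X Y (Uᴴ * diagonal (fun i => (d i : ℂ)) * F)
      (Uᴴ * diagonal (fun i => (d i : ℂ)) * U - 1) =
      ((∑ i, (Real.log (d i) - d i * ∑ l, ‖errorCoeff H N₀ U F i l‖ ^ 2 + 1) : ℝ) : EReal) := by
  have hstd : IsStdComplexGaussian (source N₀ X N) μ :=
    isStdComplexGaussian_sumElim hN₀ hX hN hXlaw hNlaw hXN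
  have hV : Measurable (source N₀ X N) := measurable_source hX hN
  have hin := fun i => hstd.integrable_sq hV (inputCoeff nR i)
  have hin2 := fun i => hstd.integral_sq hV (inputCoeff nR i)
  have herr := fun U F i => hstd.integrable_sq hV (errorCoeff H N₀ U F i)
  have herr2 := fun U F i => hstd.integral_sq hV (errorCoeff H N₀ U F i)
  simp_rw [form_inputCoeff, sum_sq_inputCoeff] at hin hin2
  simp_rw [form_errorCoeff hN₀ hY] at herr herr2
  -- Integrability of `|(FY)ᵢ|²` is the case `U = 0` of `herr`.
  rw [gmi_eq_of_quadratic μ X Y hXlaw _ _ U hU d hd F (receiver_exponent_eq U F d) hin hin2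
    (fun i => by simpa using herr 0 F i) (herr U F)]
  simp_rw [herr2]

end Channel

/-! ### Optimization over the receiver. -/

/-- This is `log x ≤ x - 1` at `x = d s`, with equality at `d = 1 / s`, the choice made for
attainment. -/
theorem log_sub_mul_add_one_le {d s : ℝ} (hd : 0 < d) (hs : 0 < s) :
    Real.log d - d * s + 1 ≤ -Real.log s := by
  have := Real.log_le_sub_one_of_pos (mul_pos hd hs)
  rw [Real.log_mul hd.ne' hs.ne'] at this
  linarith

end ChannelShortening

end

open ChannelShortening in
theorem lemma1 {Ω : Type*} [MeasurableSpace Ω] (μ : Measure Ω) [IsProbabilityMeasure μ]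
    (nR nT M : ℕ) (K : Fin M → ℕ) (hK : ∑ m, K m = nT)
    (H : Matrix (Fin nR) (Fin nT) ℂ) (N₀ : ℝ) (hN₀ : 0 < N₀)
    (X : Ω → Fin nT → ℂ) (N : Ω → Fin nR → ℂ) (hX : Measurable X) (hN : Measurable N)
    (hXlaw : μ.map X = ChannelShortening.complexGaussianVec nT 1)
    (hNlaw : μ.map N = ChannelShortening.complexGaussianVec nR N₀)
    (hXN : IndepFun X N μ)
    (Y : Ω → Fin nR → ℂ) (hY : ∀ ω, Y ω = H *ᵥ X ω + N ω) :
    IsGreatest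
      {r : EReal | ∃ (Hr : Matrix (Fin nT) (Fin nR) ℂ) (Gr : Matrix (Fin nT) (Fin nT) ℂ),
        Gr.IsHermitian ∧ ChannelShortening.IsBlockDiagonal hK Gr ∧
          r = ChannelShortening.gmi μ X Y Hr Gr}
      ((∑ m : Fin M, ∑ k : Fin (K m),
        ChannelShortening.condMutualInfo μ Y (fun ω => X ω (ChannelShortening.blockIdx hK m k))
          (ChannelShortening.blockPast hK X m k) : ℝ≥0∞) : EReal) := by
  obtain ⟨U, F, hU, horthX, horthY, hmin⟩ := exists_mmse H N₀ (blockOf hK)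
  set s : Fin nT → ℝ := fun i => ∑ l, ‖errorCoeff H N₀ U F i l‖ ^ 2
  have hs : ∀ i, 0 < s i := by
    intro i
    obtain ⟨l, hl⟩ := Function.ne_iff.1 (errorCoeff_ne_zero H hN₀ U F i (hU.1 i))
    exact Finset.sum_pos' (fun _ _ => by positivity)
      ⟨l, Finset.mem_univ l, by have := norm_pos_iff.2 hl; positivity⟩
  -- Comparison with the trivial estimate zero (`U = 1`, `F = 0`). It makes `-log (s i)`
  -- nonnegative, so nothing is truncated by `ENNReal.ofReal`.
  have hs1 : ∀ i, s i ≤ 1 := by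
    intro i
    have := hmin 1 0 (isBlockUnitLower_one _) i
    rwa [errorCoeff_one_zero, sum_sq_inputCoeff] at this
  have hval : ((∑ m : Fin M, ∑ k : Fin (K m),
        condMutualInfo μ Y (fun ω => X ω (blockIdx hK m k))
          (blockPast hK X m k) : ℝ≥0∞) : EReal) = ((∑ i, -Real.log (s i) : ℝ) : EReal) := by
    simp_rw [condMutualInfo_eq_neg_log hN₀ hX hN hXlaw hNlaw hXN hY hU horthX horthY]
    have hnn : ∀ i, 0 ≤ -Real.log (s i) := fun i =>
      neg_nonneg.2 (Real.log_nonpos (hs i).le (hs1 i))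
    rw [sum_sum_blockIdx hK fun i => ENNReal.ofReal (-Real.log (s i)),
      ← ENNReal.ofReal_sum_of_nonneg fun i _ => hnn i,
      EReal.coe_ennreal_ofReal, max_eq_left (Finset.sum_nonneg fun i _ => hnn i)]
  rw [hval]
  constructor
  · have hsC : (fun i => (((s i)⁻¹ : ℝ) : ℂ)) = star fun i => (((s i)⁻¹ : ℝ) : ℂ) := by
      funext i
      exact (Complex.conj_ofReal _).symm
    refine ⟨Uᴴ * diagonal (fun i => (((s i)⁻¹ : ℝ) : ℂ)) * F,
      Uᴴ * diagonal (fun i => (((s i)⁻¹ : ℝ) : ℂ)) * U - 1, ?_, ?_, ?_⟩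
    · refine IsHermitian.sub (isHermitian_conjTranspose_mul_mul U ?_) isHermitian_one
      rw [IsHermitian, diagonal_conjTranspose, ← hsC]
    · rw [isBlockDiagonal_iff]
      intro i j hij
      rw [Matrix.sub_apply, one_apply_ne fun h : i = j => hij (congrArg _ h), sub_zero, Matrix.mul_apply]
      refine Finset.sum_eq_zero fun k _ => ?_
      rw [mul_diagonal, conjTranspose_apply]
      -- Since `i` and `j` lie in different blocks, `k` misses one of them and the corresponding
      -- entry of `U` is zero.
      by_cases h : blockOf hK k = blockOf hK i
      · rw [hU.2.2 k j (h ▸ hij), mul_zero]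
      · rw [hU.2.2 k i h, star_zero, zero_mul, zero_mul]
    · rw [gmi_eq_sum hN₀ hX hN hXlaw hNlaw hXN hY U hU.det_eq_one F _ fun i => inv_pos.2 (hs i)]
      congr 1
      refine Finset.sum_congr rfl fun i _ => ?_
      change _ = Real.log (s i)⁻¹ - (s i)⁻¹ * s i + 1
      rw [inv_mul_cancel₀ (hs i).ne', Real.log_inv]
      ring
  · rintro r ⟨Hr, Gr, hGr, hGrb, rfl⟩
    by_cases hpos : ∃ v : Fin nT → ℂ, v ≠ 0 ∧
        ∑ i, ‖v i‖ ^ 2 + (star v ⬝ᵥ (Gr *ᵥ v)).re ≤ 0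
    · obtain ⟨v, hv, hv0⟩ := hpos
      rw [gmi_eq_bot μ X Y hXlaw Hr Gr v hv hv0]
      exact bot_le
    push Not at hpos
    rw [isBlockDiagonal_iff] at hGrb
    obtain ⟨W, d, hd, hW1, hWt, hWβ, hA⟩ := exists_ldl (blockOf hK) (Gr + 1)
      (hGr.add isHermitian_one)
      (by
        intro v hv
        have h := hpos v hv
        have h2 : (star v ⬝ᵥ v).re = ∑ i, ‖v i‖ ^ 2 := by
          rw [dotProduct, Complex.re_sum]
          refine Finset.sum_congr rfl fun i _ => ?_
          rw [← Complex.normSq_eq_norm_sq, Complex.normSq_apply]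
          simp [Complex.mul_re]
        rw [add_mulVec, one_mulVec, dotProduct_add, Complex.add_re, h2]
        linarith)
      (fun i j hij => by
        rw [Matrix.add_apply, hGrb i j hij, one_apply_ne fun h : i = j => hij (congrArg _ h), add_zero])
    have hW : IsBlockUnitLower (blockOf hK) W := ⟨hW1, hWt, hWβ⟩
    have hdC : ∀ i, (d i : ℂ) ≠ 0 := fun i => by exact_mod_cast (hd i).ne'
    have hdet : IsUnit (Wᴴ * diagonal (fun i => (d i : ℂ))).det := by
      rw [det_mul, det_conjTranspose, hW.det_eq_one, det_diagonal, star_one, one_mul]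
      exact (Finset.prod_ne_zero_iff.2 fun i _ => hdC i).isUnit
    -- Invertibility of `Wᴴ D` puts an arbitrary `Hr` in the factored form, so the restriction to
    -- `Uᴴ D F` loses nothing.
    have hHr : Hr = Wᴴ * diagonal (fun i => (d i : ℂ)) *
        ((Wᴴ * diagonal (fun i => (d i : ℂ)))⁻¹ * Hr) := by
      rw [← Matrix.mul_assoc, Matrix.mul_nonsing_inv _ hdet, Matrix.one_mul]
    rw [eq_sub_of_add_eq hA, hHr,
      gmi_eq_sum hN₀ hX hN hXlaw hNlaw hXN hY W hW.det_eq_one _ d hd, EReal.coe_le_coe_iff]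
    refine Finset.sum_le_sum fun i _ => ?_
    -- First lower the error variance to its MMSE value, then optimize over `d i`.
    refine le_trans ?_ (log_sub_mul_add_one_le (hd i) (hs i))
    have := mul_le_mul_of_nonneg_left
      (hmin W ((Wᴴ * diagonal (fun i => (d i : ℂ)))⁻¹ * Hr) hW i) (hd i).le
    linarith
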